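/- Let $k$ be a field, and let $\mathcal C$ be a $k$-category: a small category whose morphism sets ${}_y\mathcal C_x$ (from $x$ to $y$) are $k$-vector spaces and whose composition is $k$-bilinear. Let $G$ be a group acting $k$-linearly on $\mathcal C$ and freely on its objects ($sx=x$ implies $s=1$), and let $\mathcal C\to\mathcal B=\mathcal C/G$ be the corresponding Galois covering: the objects of $\mathcal B$ are the $G$-orbits of objects of $\mathcal C$, one has ${}_v\mathcal B_u=\bigl(\bigoplus_{x\in u,\,y\in v}{}_y\mathcal C_x\bigr)_G$ (coinvariants), composition is induced by that of $\mathcal C$, and the functor is the projection $c\mapsto\overline c$. For a bimodule $\mathcal M$ over a $k$-category $\mathcal D$ (a $k$-bilinear bifunctor $\mathcal D\times\mathcal D^{op}\to k\text{-}\mathrm{Vect}$, with values ${}_y\mathcal M_x$), the Hochschild–Mitchell homology $H_*(\mathcal D,\mathcal M)$ is the homology of the complex $$C_n(\mathcal D,\mathcal M)=\bigoplus_{(x_{n+1},\dots,x_1)}{}_{x_1}\mathcal M_{x_{n+1}}\otimes_k{}_{x_{n+1}}\mathcal D_{x_n}\otimes_k\cdots\otimes_k{}_{x_2}\mathcal D_{x_1},$$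 the sum being over all sequences of $n+1$ objects, with the usual Hochschild boundary $$d(m\otimes c_n\otimes\cdots\otimes c_1)=mc_n\otimes c_{n-1}\otimes\cdots\otimes c_1+\sum_{i=1}^{n-1}(-1)^i\,m\otimes c_n\otimes\cdots\otimes c_{n-i+1}c_{n-i}\otimes\cdots\otimes c_1+(-1)^n\,c_1m\otimes c_n\otimes\cdots\otimes c_2 .$$ Let $\mathcal M$ be a $\mathcal B$-bimodule and let $L\mathcal M$ be the lifted $\mathcal C$-bimodule, ${}_y(L\mathcal M)_x={}_{\overline y}\mathcal M_{\overline x}$, on which $\mathcal C$ acts through the projection. The group $G$ acts on $C_*(\mathcal C,L\mathcal M)$ by $s(m\otimes c_n\otimes\cdots\otimes c_1)=m\otimes sc_n\otimes\cdots\otimes sc_1$, so that every $H_q(\mathcal C,L\mathcal M)$ is a $kG$-module. Then there is a first quadrant homological spectral sequence of $k$-vector spaces, with differentials $d^r\colon E^r_{p,q}\to E^r_{p-r,q+r-1}$ for $r\ge 2$, with level $2$ term $$E^2_{p,q}\cong H_p\bigl(G,H_q(\mathcal C,L\mathcal M)\bigr)\qquad(p,q\ge 0),$$ where $H_p(G,X)$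 denotes the usual group homology with coefficients in a $kG$-module $X$, and which converges to $H_n(\mathcal B,\mathcal M)$: for every $n\ge 0$ there is a filtration $0=F_{-1}\subseteq F_0\subseteq\dots\subseteq F_n=H_n(\mathcal B,\mathcal M)$ with $F_p/F_{p-1}\cong E^\infty_{p,n-p}$ for $0\le p\le n$. -/

import Mathlib

open CategoryTheory
open scoped TensorProduct

universe u

namespace CartanLeray

noncomputable section

lemma exists_smul_eq {G : Type u} [Group G] {C : Type u} [MulAction G C]
    {v : MulAction.orbitRel.Quotient G C} 
    (y y' : v.orbit) : ∃ g : G, g • y = y' := by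
  have h : (⟦(y' : C)⟧ : MulAction.orbitRel.Quotient G C) = ⟦(y : C)⟧ :=
    (MulAction.orbitRel.Quotient.mem_orbit.1 y'.2).trans
      (MulAction.orbitRel.Quotient.mem_orbit.1 y.2).symm
  obtain ⟨g, hg⟩ := Quotient.exact h
  exact ⟨g, Subtype.ext hg⟩

lemma comp_heq {C : Type u} [SmallCategory C] {x x' y y' z z' : C} (hx : x = x') (hy : y = y') (hz : z = z')
    {c : x ⟶ y} {c' : x' ⟶ y'} (hc : HEq c c') {d : y ⟶ z} {d' : y' ⟶ z'} (hd : HEq d d') :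
    HEq (c ≫ d) (c' ≫ d') := by
  subst hx hy hz
  cases hc
  cases hd
  rfl

lemma eqToHom_comp_heq' {C : Type u} [SmallCategory C] {y y' z : C} (h : y = y') (d : y' ⟶ z) : HEq (eqToHom h ≫ d) d := by
  subst h
  simp

section Bimodule

variable (k : Type u) [CommRing k]

/-- A bimodule over a `k`-category `C`: modules `obj y x` (written `_y M _x` on paper), covariant
in `y` and contravariant in `x`, through bilinear left and right actions. Here `lact c m` is the
product `c m` and `ract c m` is the product `m c`. Composites in `C` are written in diagrammatic
order, so that the composite usually denoted `d c` is `c ≫ d`. -/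
structure Bimodule (C : Type u) [SmallCategory C] [Preadditive C] [Linear k C] where
  obj : C → C → Type u
  [addCommGroup : ∀ y x, AddCommGroup (obj y x)]
  [module : ∀ y x, Module k (obj y x)]
  lact {x y z : C} : (y ⟶ z) →ₗ[k] obj y x →ₗ[k] obj z x
  ract {u x y : C} : (u ⟶ x) →ₗ[k] obj y x →ₗ[k] obj y u
  lact_lact {x y z w : C} (d : z ⟶ w) (c : y ⟶ z) (m : obj y x) :
    lact d (lact c m) = lact (c ≫ d) m
  ract_ract {y x u v : C} (d : v ⟶ u) (c : u ⟶ x) (m : obj y x) :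
    ract d (ract c m) = ract (d ≫ c) m
  lact_ract {u x y z : C} (c : y ⟶ z) (d : u ⟶ x) (m : obj y x) :
    lact c (ract d m) = ract d (lact c m)
  lact_id {y x : C} (m : obj y x) : lact (𝟙 y) m = m
  ract_id {y x : C} (m : obj y x) : ract (𝟙 x) m = m

attribute [instance] Bimodule.addCommGroup Bimodule.module

namespace Bimodule

variable {k} {C D : Type u} [SmallCategory C] [Preadditive C] [Linear k C]
  [SmallCategory D] [Preadditive D] [Linear k D]

/-- The bimodule over `C` lifted from a bimodule over `D` along a `k`-linear functor `C ⥤ D`. -/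
def lift (M : Bimodule k D) (F : C ⥤ D) [F.Additive] [F.Linear k] : Bimodule k C where
  obj y x := M.obj (F.obj y) (F.obj x)
  lact := M.lact ∘ₗ F.mapLinearMap k
  ract := M.ract ∘ₗ F.mapLinearMap k
  lact_lact d c m := by simp [M.lact_lact]
  ract_ract d c m := by simp [M.ract_ract]
  lact_ract c d m := by simp [M.lact_ract]
  lact_id m := by simp [M.lact_id]
  ract_id m := by simp [M.ract_id]

/-- The identification of `_y M _x` with `_y' M _x'` when `y = y'` and `x = x'`. -/
def castEquiv (M : Bimodule k D) {y y' x x' : D} (hy : y = y') (hx : x = x') :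
    M.obj y x ≃ₗ[k] M.obj y' x' := by
  subst hy hx
  exact LinearEquiv.refl k _

lemma castEquiv_heq (M : Bimodule k D) {y y' x x' : D} (hy : y = y') (hx : x = x')
    (m : M.obj y x) : HEq (M.castEquiv hy hx m) m := by
  subst hy hx
  rfl

lemma lact_castEquiv (M : Bimodule k D) {x x' y y' z z' : D} (hx : x = x') (hy : y = y')
    (hz : z = z') {c : y ⟶ z} {c' : y' ⟶ z'} (hc : HEq c c') (m : M.obj y x) :
    M.lact c' (M.castEquiv hy hx m) = M.castEquiv hz hx (M.lact c m) := by
  subst hx hy hz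
  cases hc
  rfl

lemma ract_castEquiv (M : Bimodule k D) {x x' y y' z z' : D} (hx : x = x') (hy : y = y')
    (hz : z = z') {c : z ⟶ x} {c' : z' ⟶ x'} (hc : HEq c c') (m : M.obj y x) :
    M.ract c' (M.castEquiv hy hx m) = M.castEquiv hy hz (M.ract c m) := by
  subst hx hy hz
  cases hc
  rfl

end Bimodule

end Bimodule

/-- A `k`-linear action of a group `G` on a `k`-category `C`, which is free on objects. The action
on objects is the given `MulAction`; `map s c` is the morphism `s c` from `s x` to `s y`, for a
morphism `c` from `x` to `y`. -/
structure FreeAction (k : Type u) [CommRing k] (G : Type u) [Group G] (C : Type u)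
    [SmallCategory C] [Preadditive C] [Linear k C] [MulAction G C] where
  map (s : G) {x y : C} : (x ⟶ y) →ₗ[k] (s • x ⟶ s • y)
  map_comp (s : G) {x y z : C} (c : x ⟶ y) (d : y ⟶ z) : map s (c ≫ d) = map s c ≫ map s d
  map_one {x y : C} (c : x ⟶ y) : HEq (map 1 c) c
  map_mul (s t : G) {x y : C} (c : x ⟶ y) : HEq (map (s * t) c) (map s (map t c))
  free (s : G) (x : C) : s • x = x → s = 1

namespace FreeAction

variable {k : Type u} [CommRing k] {G : Type u} [Group G] {C : Type u}
    [SmallCategory C] [Preadditive C] [Linear k C] [MulAction G C] (A : FreeAction k G C)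

lemma map_heq (s : G) {x y x' y' : C} (hx : x = x') (hy : y = y') {c : x ⟶ y} {c' : x' ⟶ y'}
    (hc : HEq c c') : HEq (A.map s c) (A.map s c') := by
  subst hx hy
  cases hc
  rfl

lemma map_inv_map (s : G) {x y : C} (c : x ⟶ y) : HEq (A.map s⁻¹ (A.map s c)) c := by
  have h : HEq (A.map (s⁻¹ * s) c) (A.map 1 c) := by rw [inv_mul_cancel]
  exact ((A.map_mul s⁻¹ s c).symm.trans h).trans (A.map_one c)

lemma map_surjective (s : G) (x y : C) :
    Function.Surjective (A.map s : (x ⟶ y) → (s • x ⟶ s • y)) := by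
  intro c
  have hx := inv_smul_smul s x
  have hy := inv_smul_smul s y
  obtain ⟨c', hc'⟩ : ∃ c' : x ⟶ y, HEq c' (A.map s⁻¹ c) := by
    generalize A.map s⁻¹ c = d
    generalize s⁻¹ • s • x = x' at *
    generalize s⁻¹ • s • y = y' at *
    subst hx hy
    exact ⟨d, HEq.rfl⟩
  refine ⟨c', eq_of_heq ((A.map_heq s hx.symm hy.symm hc').trans ?_)⟩
  have := A.map_inv_map s⁻¹ c
  rwa [inv_inv] at this

@[simp]
lemma map_id (s : G) (x : C) : A.map s (𝟙 x) = 𝟙 (s • x) := by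
  obtain ⟨c, hc⟩ := A.map_surjective s x x (𝟙 (s • x))
  have h := A.map_comp s (𝟙 x) c
  rw [Category.id_comp, hc, Category.comp_id] at h
  exact h.symm

section QuotientCategory

open scoped Classical

/-- The direct sum of the modules of morphisms from an object of the orbit `u` to an object of the
orbit `v`. -/
abbrev OrbitHom (k : Type u) [CommRing k] {G : Type u} [Group G] {C : Type u}
    [SmallCategory C] [Preadditive C] [Linear k C] [MulAction G C]
    (u v : MulAction.orbitRel.Quotient G C) : Type u :=
  DirectSum (u.orbit × v.orbit) (fun p => ((p.1 : C) ⟶ (p.2 : C)))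

/-- The action of `s` on the morphisms between two objects of the orbits `u` and `v`. -/
def omap (s : G) {u v : MulAction.orbitRel.Quotient G C} {x : u.orbit} {y : v.orbit} :
    ((x : C) ⟶ y) →ₗ[k] (((s • x : u.orbit) : C) ⟶ (s • y : v.orbit)) :=
  A.map s

lemma omap_comp (s : G) {u v w : MulAction.orbitRel.Quotient G C} {x : u.orbit} {y : v.orbit}
    {z : w.orbit} (c : (x : C) ⟶ y) (d : (y : C) ⟶ z) :
    A.omap s (c ≫ d) = A.omap s c ≫ A.omap s d :=
  A.map_comp s c d

lemma omap_id (s : G) {u : MulAction.orbitRel.Quotient G C} (x : u.orbit) :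
    A.omap s (𝟙 (x : C)) = 𝟙 ((s • x : u.orbit) : C) :=
  A.map_id s x

lemma omap_one {u v : MulAction.orbitRel.Quotient G C} {x : u.orbit} {y : v.orbit}
    (c : (x : C) ⟶ y) : HEq (A.omap 1 c) c :=
  A.map_one c

lemma omap_mul (s t : G) {u v : MulAction.orbitRel.Quotient G C} {x : u.orbit} {y : v.orbit}
    (c : (x : C) ⟶ y) : HEq (A.omap (s * t) c) (A.omap s (A.omap t c)) :=
  A.map_mul s t c

lemma omap_inv_omap (s : G) {u v : MulAction.orbitRel.Quotient G C} {x : u.orbit} {y : v.orbit}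
    (c : (x : C) ⟶ y) : HEq (A.omap s⁻¹ (A.omap s c)) c :=
  A.map_inv_map s c

/-- The inclusion of the module of morphisms from `x` to `y` in the direct sum. -/
def incl {u v : MulAction.orbitRel.Quotient G C} (x : u.orbit) (y : v.orbit) :
    ((x : C) ⟶ y) →ₗ[k] OrbitHom k u v :=
  DirectSum.lof k (u.orbit × v.orbit) (fun p => ((p.1 : C) ⟶ (p.2 : C))) (x, y)

lemma incl_heq {u v : MulAction.orbitRel.Quotient G C} {x x' : u.orbit} {y y' : v.orbit}
    (hx : x = x') (hy : y = y') {c : (x : C) ⟶ y} {c' : (x' : C) ⟶ y'} (h : HEq c c') :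
    incl (k := k) x y c = incl x' y' c' := by
  subst hx hy
  cases h
  rfl

/-- The linear map out of the direct sum with the given components. -/
def desc {u v : MulAction.orbitRel.Quotient G C} {N : Type u} [AddCommGroup N] [Module k N]
    (f : ∀ (x : u.orbit) (y : v.orbit), ((x : C) ⟶ y) →ₗ[k] N) : OrbitHom k u v →ₗ[k] N :=
  DirectSum.toModule k _ _ (fun p => f p.1 p.2)

@[simp]
lemma desc_incl {u v : MulAction.orbitRel.Quotient G C} {N : Type u} [AddCommGroup N] [Module k N]
    (f : ∀ (x : u.orbit) (y : v.orbit), ((x : C) ⟶ y) →ₗ[k] N) (x : u.orbit) (y : v.orbit)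
    (c : (x : C) ⟶ y) : desc f (incl x y c) = f x y c :=
  DirectSum.toModule_lof k (M := fun p : u.orbit × v.orbit => ((p.1 : C) ⟶ (p.2 : C)))
    (φ := fun p => f p.1 p.2) (x, y) c

lemma orbitHom_ext {u v : MulAction.orbitRel.Quotient G C} {N : Type u} [AddCommGroup N]
    [Module k N] {f g : OrbitHom k u v →ₗ[k] N}
    (h : ∀ (x : u.orbit) (y : v.orbit) (c : (x : C) ⟶ y), f (incl x y c) = g (incl x y c)) :
    f = g :=
  DirectSum.linearMap_ext _ fun p => LinearMap.ext fun c => h p.1 p.2 c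

/-- The representation of `G` on the direct sum of the modules of morphisms between two orbits. -/
def orbitHomRep (u v : MulAction.orbitRel.Quotient G C) :
    Representation k G (OrbitHom k u v) where
  toFun s := desc fun x y => incl (s • x) (s • y) ∘ₗ A.omap s
  map_one' := orbitHom_ext fun x y c => by
    rw [desc_incl, LinearMap.comp_apply]
    exact incl_heq (one_smul G x) (one_smul G y) (A.omap_one c)
  map_mul' s t := orbitHom_ext fun x y c => by
    rw [Module.End.mul_apply, desc_incl, desc_incl, LinearMap.comp_apply, LinearMap.comp_apply,
      desc_incl, LinearMap.comp_apply]
    exact incl_heq (mul_smul s t x) (mul_smul s t y) (A.omap_mul s t c)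

lemma orbitHomRep_incl {u v : MulAction.orbitRel.Quotient G C} (s : G) (x : u.orbit)
    (y : v.orbit) (c : (x : C) ⟶ y) :
    A.orbitHomRep u v s (incl x y c) = incl (s • x) (s • y) (A.omap s c) :=
  desc_incl (fun x y => incl (s • x) (s • y) ∘ₗ A.omap s) x y c

/-- The module of morphisms from the orbit `u` to the orbit `v` in the quotient category: the
coinvariants of the direct sum of the modules of morphisms from an object of `u` to one of `v`. -/
abbrev QuotientHom (u v : MulAction.orbitRel.Quotient G C) : Type u :=
  (A.orbitHomRep u v).Coinvariants

/-- The class of a morphism of `C` in the quotient category. -/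
def cls {u v : MulAction.orbitRel.Quotient G C} (x : u.orbit) (y : v.orbit) :
    ((x : C) ⟶ y) →ₗ[k] A.QuotientHom u v :=
  Representation.Coinvariants.mk _ ∘ₗ incl x y

lemma cls_smul {u v : MulAction.orbitRel.Quotient G C} (x : u.orbit) (y : v.orbit)
    (c : (x : C) ⟶ y) (s : G) : A.cls (s • x) (s • y) (A.omap s c) = A.cls x y c := by
  have h := Representation.Coinvariants.mk_self_apply (A.orbitHomRep u v) s (incl x y c)
  rw [orbitHomRep_incl] at h
  exact h

lemma cls_heq {u v : MulAction.orbitRel.Quotient G C} {x x' : u.orbit} {y y' : v.orbit}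
    (hx : x = x') (hy : y = y') {c : (x : C) ⟶ y} {c' : (x' : C) ⟶ y'} (h : HEq c c') :
    A.cls x y c = A.cls x' y' c' := by
  subst hx hy
  cases h
  rfl

/-- The linear map out of a module of morphisms of the quotient category with the given values on
classes. -/
def qdesc {u v : MulAction.orbitRel.Quotient G C} {N : Type u} [AddCommGroup N] [Module k N]
    (f : ∀ (x : u.orbit) (y : v.orbit), ((x : C) ⟶ y) →ₗ[k] N)
    (hf : ∀ (s : G) (x : u.orbit) (y : v.orbit) (c : (x : C) ⟶ y),
      f (s • x) (s • y) (A.omap s c) = f x y c) : A.QuotientHom u v →ₗ[k] N :=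
  Representation.Coinvariants.lift _ (desc f) fun s => orbitHom_ext fun x y c => by
    rw [LinearMap.comp_apply, orbitHomRep_incl, desc_incl, desc_incl]
    exact hf s x y c

@[simp]
lemma qdesc_cls {u v : MulAction.orbitRel.Quotient G C} {N : Type u} [AddCommGroup N] [Module k N]
    (f : ∀ (x : u.orbit) (y : v.orbit), ((x : C) ⟶ y) →ₗ[k] N)
    (hf : ∀ (s : G) (x : u.orbit) (y : v.orbit) (c : (x : C) ⟶ y),
      f (s • x) (s • y) (A.omap s c) = f x y c) (x : u.orbit) (y : v.orbit)
    (c : (x : C) ⟶ y) : A.qdesc f hf (A.cls x y c) = f x y c :=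
  desc_incl f x y c

lemma smul_injective (A : FreeAction k G C) {v : MulAction.orbitRel.Quotient G C} (y : v.orbit) {g g' : G}
    (h : g • y = g' • y) : g = g' := by
  have h1 : (g'⁻¹ * g) • (y : C) = y := by
    rw [mul_smul, inv_smul_eq_iff]
    exact congrArg Subtype.val h
  exact (inv_mul_eq_one.1 (A.free _ _ h1)).symm

lemma qhom_induction {u v : MulAction.orbitRel.Quotient G C} (x : u.orbit)
    {P : A.QuotientHom u v → Prop} (h0 : P 0) (hadd : ∀ a b, P a → P b → P (a + b))
    (hcls : ∀ (y : v.orbit) (c : (x : C) ⟶ y), P (A.cls x y c)) (a : A.QuotientHom u v) : P a := by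
  obtain ⟨a, rfl⟩ := Representation.Coinvariants.mk_surjective _ a
  induction a using DirectSum.induction_on with
  | zero => simpa using h0
  | add a b ha hb => simpa using hadd _ _ ha hb
  | of p c =>
    obtain ⟨x', y⟩ := p
    obtain ⟨g, rfl⟩ := exists_smul_eq x' x
    have := hcls (g • y) (A.omap g c)
    rw [cls_smul] at this
    exact this

/-- The class of the composite of a morphism from `x` to `y` and a morphism from `y'` to `z`, for
`y` and `y'` in the same orbit, after translation of the former by the unique `g` with
`g y = y'`. -/
def translateComp {u v w : MulAction.orbitRel.Quotient G C} (x : u.orbit) (y y' : v.orbit)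
    (z : w.orbit) : ((x : C) ⟶ y) →ₗ[k] ((y' : C) ⟶ z) →ₗ[k] A.QuotientHom u w :=
  LinearMap.mk₂ k
    (fun c d => A.cls ((exists_smul_eq y y').choose • x) z
      (A.omap (exists_smul_eq y y').choose c ≫
        eqToHom (congrArg Subtype.val (exists_smul_eq y y').choose_spec) ≫ d))
    (fun _ _ _ => by rw [map_add, Preadditive.add_comp, map_add])
    (fun _ _ _ => by rw [map_smul, Linear.smul_comp, map_smul])
    (fun _ _ _ => by rw [Preadditive.comp_add, Preadditive.comp_add, map_add])
    (fun _ _ _ => by rw [Linear.comp_smul, Linear.comp_smul, map_smul])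

lemma translateComp_eq {u v w : MulAction.orbitRel.Quotient G C} (x : u.orbit) (y y' : v.orbit)
    (z : w.orbit) (g : G) (hg : g • y = y') (c : (x : C) ⟶ y) (d : (y' : C) ⟶ z) :
    A.translateComp x y y' z c d =
      A.cls (g • x) z (A.omap g c ≫ eqToHom (congrArg Subtype.val hg) ≫ d) := by
  have h : (exists_smul_eq y y').choose = g :=
    A.smul_injective y ((exists_smul_eq y y').choose_spec.trans hg.symm)
  subst h
  rfl

/-- Composition in the quotient category. -/
def qcomp {u v w : MulAction.orbitRel.Quotient G C} :
    A.QuotientHom u v →ₗ[k] A.QuotientHom v w →ₗ[k] A.QuotientHom u w :=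
  A.qdesc
    (fun x y => (A.qdesc (fun y' z => (A.translateComp x y y' z).flip) (by
      intro s y' z d
      ext c
      obtain ⟨g, rfl⟩ := exists_smul_eq y y'
      rw [LinearMap.flip_apply, LinearMap.flip_apply, A.translateComp_eq x y _ z g rfl,
        A.translateComp_eq x y _ (s • z) (s * g) (mul_smul s g y), ← A.cls_smul (g • x) z _ s]
      refine A.cls_heq (mul_smul s g x) rfl ?_
      rw [A.omap_comp]
      refine comp_heq (mul_smul s g (x : C)) (mul_smul s g (y : C)) rfl (A.omap_mul s g c) ?_
      refine (eqToHom_comp_heq' _ _).trans ?_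
      exact heq_of_eq (congrArg (A.omap s) (Category.id_comp d).symm))).flip)
    (by
      intro s x y c
      refine LinearMap.ext fun a => ?_
      obtain ⟨y0, hy0⟩ := v.nonempty_orbit
      refine A.qhom_induction (P := fun a => _ = _) y (by simp)
        (fun a b ha hb => by simp only [map_add, ha, hb]) (fun z d => ?_) a
      rw [LinearMap.flip_apply, LinearMap.flip_apply, qdesc_cls, qdesc_cls, LinearMap.flip_apply,
        LinearMap.flip_apply, A.translateComp_eq x y y z 1 (one_smul G y),
        A.translateComp_eq (s • x) (s • y) y z s⁻¹ (inv_smul_smul s y)]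
      refine A.cls_heq ((inv_smul_smul s x).trans (one_smul G x).symm) rfl ?_
      refine comp_heq (congrArg Subtype.val ((inv_smul_smul s x).trans (one_smul G x).symm))
        (congrArg Subtype.val ((inv_smul_smul s y).trans (one_smul G y).symm)) rfl
        ((A.omap_inv_omap s c).trans (A.omap_one c).symm) ?_
      exact (eqToHom_comp_heq' _ _).trans (eqToHom_comp_heq' _ _).symm)

lemma qcomp_add_left {u v w : MulAction.orbitRel.Quotient G C} (a b : A.QuotientHom u v)
    (c : A.QuotientHom v w) : A.qcomp (a + b) c = A.qcomp a c + A.qcomp b c :=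
  LinearMap.map_add₂ A.qcomp a b c

lemma qcomp_smul_left {u v w : MulAction.orbitRel.Quotient G C} (r : k) (a : A.QuotientHom u v)
    (b : A.QuotientHom v w) : A.qcomp (r • a) b = r • A.qcomp a b :=
  LinearMap.map_smul₂ A.qcomp r a b

lemma qcomp_add_right {u v w : MulAction.orbitRel.Quotient G C} (a : A.QuotientHom u v)
    (b c : A.QuotientHom v w) : A.qcomp a (b + c) = A.qcomp a b + A.qcomp a c :=
  map_add (A.qcomp a) b c

lemma qcomp_smul_right {u v w : MulAction.orbitRel.Quotient G C} (r : k) (a : A.QuotientHom u v)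
    (b : A.QuotientHom v w) : A.qcomp a (r • b) = r • A.qcomp a b :=
  map_smul (A.qcomp a) r b

lemma qcomp_cls_translate {u v w : MulAction.orbitRel.Quotient G C} (x : u.orbit) (y y' : v.orbit)
    (z : w.orbit) (c : (x : C) ⟶ y) (d : (y' : C) ⟶ z) :
    A.qcomp (A.cls x y c) (A.cls y' z d) = A.translateComp x y y' z c d := by
  simp [qcomp]

lemma qcomp_cls {u v w : MulAction.orbitRel.Quotient G C} (x : u.orbit) (y : v.orbit)
    (z : w.orbit) (c : (x : C) ⟶ y) (d : (y : C) ⟶ z) :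
    A.qcomp (A.cls x y c) (A.cls y z d) = A.cls x z (c ≫ d) := by
  rw [qcomp_cls_translate, A.translateComp_eq x y y z 1 (one_smul G y)]
  refine A.cls_heq (one_smul G x) rfl ?_
  exact comp_heq (one_smul G (x : C)) (one_smul G (y : C)) rfl (A.omap_one c)
    (eqToHom_comp_heq' _ _)

lemma cls_id {u : MulAction.orbitRel.Quotient G C} (x x' : u.orbit) :
    A.cls x x (𝟙 (x : C)) = A.cls x' x' (𝟙 (x' : C)) := by
  obtain ⟨g, rfl⟩ := exists_smul_eq x x'
  rw [← A.cls_smul x x (𝟙 (x : C)) g, A.omap_id]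

/-- The quotient category `C/G`: its objects are the orbits of objects of `C`. -/
structure QuotientCategory (A : FreeAction k G C) : Type u where
  orbit : MulAction.orbitRel.Quotient G C

/-- An object of an orbit, chosen to write down the identity of the orbit. -/
def QuotientCategory.rep {A : FreeAction k G C} (u : A.QuotientCategory) : u.orbit.orbit :=
  ⟨u.orbit.nonempty_orbit.choose, u.orbit.nonempty_orbit.choose_spec⟩

instance : SmallCategory A.QuotientCategory where
  Hom u v := A.QuotientHom u.orbit v.orbit
  id u := A.cls u.rep u.rep (𝟙 _)
  comp a b := A.qcomp a b
  id_comp {u v} a := by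
    refine A.qhom_induction (P := fun a => A.qcomp _ a = a) u.rep (by simp)
      (fun a b ha hb => by rw [map_add, ha, hb]) (fun y c => ?_) a
    rw [qcomp_cls, Category.id_comp]
  comp_id {u v} a := by
    refine A.qhom_induction (P := fun a => A.qcomp a _ = a) u.rep (by simp)
      (fun a b ha hb => by rw [map_add, LinearMap.add_apply, ha, hb]) (fun y c => ?_) a
    rw [A.cls_id _ y, qcomp_cls, Category.comp_id]
  assoc {u v w t} a b c := by
    refine A.qhom_induction (P := fun a => A.qcomp (A.qcomp a b) c = A.qcomp a (A.qcomp b c)) u.rep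
      (by simp) (fun a b ha hb => by simp only [map_add, LinearMap.add_apply, ha, hb])
      (fun y a => ?_) a
    refine A.qhom_induction (P := fun b => A.qcomp (A.qcomp _ b) c = A.qcomp _ (A.qcomp b c)) y
      (by simp) (fun a b ha hb => by simp only [map_add, LinearMap.add_apply, ha, hb])
      (fun z b => ?_) b
    refine A.qhom_induction (P := fun c => A.qcomp (A.qcomp _ _) c = A.qcomp _ (A.qcomp _ c)) z
      (by simp) (fun a b ha hb => by simp only [map_add, ha, hb]) (fun z' c => ?_) c
    simp only [qcomp_cls, Category.assoc]

instance : Preadditive A.QuotientCategory where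
  homGroup u v := inferInstanceAs (AddCommGroup (A.QuotientHom u.orbit v.orbit))
  add_comp _ _ _ a b c := A.qcomp_add_left a b c
  comp_add _ _ _ a b c := A.qcomp_add_right a b c

instance : Linear k A.QuotientCategory where
  homModule u v := inferInstanceAs (Module k (A.QuotientHom u.orbit v.orbit))
  smul_comp _ _ _ r a b := A.qcomp_smul_left r a b
  comp_smul _ _ _ a r b := A.qcomp_smul_right r a b

/-- The orbit of an object, as an object of the quotient category. -/
def toQuotient (x : C) : A.QuotientCategory := ⟨⟦x⟧⟩

lemma toQuotient_smul (s : G) (x : C) : A.toQuotient (s • x) = A.toQuotient x :=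
  congrArg QuotientCategory.mk MulAction.orbitRel.Quotient.quotient_smul_eq

/-- An object of `C` as an element of its orbit. -/
def self (x : C) : (A.toQuotient x).orbit.orbit :=
  ⟨x, MulAction.orbitRel.Quotient.mem_orbit.2 rfl⟩

/-- The projection functor of the Galois covering `C ⥤ C/G`. -/
def proj : C ⥤ A.QuotientCategory where
  obj x := A.toQuotient x
  map {x y} c := A.cls (A.self x) (A.self y) c
  map_id _ := A.cls_id _ _
  map_comp {x y z} c d := (A.qcomp_cls (A.self x) (A.self y) (A.self z) c d).symm

instance : A.proj.Additive where
  map_add {x y} c d := map_add (A.cls (A.self x) (A.self y)) c d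

instance : A.proj.Linear k where
  map_smul {x y} c r := map_smul (A.cls (A.self x) (A.self y)) r c

lemma cls_smul_heq {u u' v v' : MulAction.orbitRel.Quotient G C} (hu : u' = u) (hv : v' = v)
    (s : G) (x : u.orbit) (y : v.orbit) (x' : u'.orbit) (y' : v'.orbit)
    (hx : (x' : C) = s • (x : C)) (hy : (y' : C) = s • (y : C)) (c : (x : C) ⟶ y)
    (c' : (x' : C) ⟶ y') (hc : HEq c' (A.map s c)) : HEq (A.cls x' y' c') (A.cls x y c) := by
  subst hu hv
  obtain rfl : x' = s • x := Subtype.ext hx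
  obtain rfl : y' = s • y := Subtype.ext hy
  cases hc
  exact heq_of_eq (A.cls_smul x y c s)

lemma proj_map_smul (s : G) {x y : C} (c : x ⟶ y) :
    HEq (A.proj.map (A.map s c)) (A.proj.map c) :=
  A.cls_smul_heq (congrArg QuotientCategory.orbit (A.toQuotient_smul s x))
    (congrArg QuotientCategory.orbit (A.toQuotient_smul s y)) s (A.self x) (A.self y)
    (A.self (s • x)) (A.self (s • y)) rfl rfl c (A.map s c) HEq.rfl

end QuotientCategory

end FreeAction

section Chains

section Paths

variable {C : Type u} [SmallCategory C]

/-- The families of composable morphisms along a sequence of objects. The sequence `x` of length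
`n + 1` is written from the left to the right, so that `x 0, …, x n` stand for the objects usually
denoted `x_{n+1}, …, x_1`, and the family consists of morphisms `c_n, …, c_1`. -/
abbrev Edges {n : ℕ} (x : Fin (n + 1) → C) (i : Fin n) : Type u := x i.succ ⟶ x i.castSucc

/-- The functor given by the sequence of objects and morphisms. -/
def pathFunctor {n : ℕ} (x : Fin (n + 1) → C) (c : ∀ i, Edges x i) : Fin (n + 1) ⥤ Cᵒᵖ :=
  ComposableArrows.mkOfObjOfMapSucc (fun i => Opposite.op (x i)) (fun i => (c i).op)

/-- The composite of the morphisms of the family which lie between the positions `i` and `j`. -/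
def path {n : ℕ} (x : Fin (n + 1) → C) (c : ∀ i, Edges x i) {i j : Fin (n + 1)} (h : i ≤ j) :
    x j ⟶ x i :=
  ((pathFunctor x c).map (homOfLE h)).unop

lemma path_self {n : ℕ} (x : Fin (n + 1) → C) (c : ∀ i, Edges x i) (i : Fin (n + 1)) :
    path x c (le_refl i) = 𝟙 (x i) :=
  congrArg Quiver.Hom.unop ((pathFunctor x c).map_id i)

lemma path_comp {n : ℕ} (x : Fin (n + 1) → C) (c : ∀ i, Edges x i) {i j l : Fin (n + 1)}
    (h : i ≤ j) (h' : j ≤ l) : path x c h' ≫ path x c h = path x c (h.trans h') :=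
  (congrArg Quiver.Hom.unop ((pathFunctor x c).map_comp (homOfLE h) (homOfLE h'))).symm

lemma path_succ {n : ℕ} (x : Fin (n + 1) → C) (c : ∀ i, Edges x i) (i : Fin n) :
    path x c (Fin.castSucc_le_succ i) = c i :=
  congrArg Quiver.Hom.unop (ComposableArrows.mkOfObjOfMapSucc_map_succ
    (fun i => Opposite.op (x i)) (fun i => (c i).op) i.1 i.2)

/-- Induction on the upper end of an interval of positions. -/
lemma path_induction {n : ℕ} (i : Fin (n + 1)) {P : ∀ j : Fin (n + 1), i ≤ j → Prop}
    (h0 : P i le_rfl)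
    (hs : ∀ (j : Fin n) (h : i ≤ j.castSucc), P j.castSucc h →
      P j.succ (h.trans (Fin.castSucc_le_succ j)))
    (j : Fin (n + 1)) (h : i ≤ j) : P j h := by
  induction j using Fin.induction with
  | zero =>
    obtain rfl : i = 0 := le_antisymm h (Fin.zero_le i)
    exact h0
  | succ j ih =>
    rcases h.lt_or_eq with h' | rfl
    · exact hs j (Fin.le_castSucc_iff.2 h') (ih _)
    · exact h0

/-- The family of composable morphisms along the sequence `x ∘ θ` obtained by composition. -/
def pull {m n : ℕ} (θ : Fin (m + 1) →o Fin (n + 1)) (x : Fin (n + 1) → C) (c : ∀ i, Edges x i) :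
    ∀ i, Edges (x ∘ θ) i :=
  fun i => path x c (θ.monotone (Fin.castSucc_le_succ i))

lemma path_pull {m n : ℕ} (θ : Fin (m + 1) →o Fin (n + 1)) (x : Fin (n + 1) → C)
    (c : ∀ i, Edges x i) (i j : Fin (m + 1)) (h : i ≤ j) :
    path (x ∘ θ) (pull θ x c) h = path x c (θ.monotone h) := by
  refine path_induction i (P := fun j h => path (x ∘ θ) (pull θ x c) h = path x c (θ.monotone h))
    ?_ (fun j h ih => ?_) j h
  · exact (path_self _ _ _).trans (path_self x c (θ i)).symm
  · rw [← path_comp _ _ h (Fin.castSucc_le_succ j), path_succ, ih]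
    exact path_comp x c (θ.monotone h) (θ.monotone (Fin.castSucc_le_succ j))

lemma path_congr {n : ℕ} (x : Fin (n + 1) → C) (c c' : ∀ i, Edges x i) (i j : Fin (n + 1))
    (h : i ≤ j) (hc : ∀ l : Fin n, i ≤ l.castSucc → l.succ ≤ j → c l = c' l) :
    path x c h = path x c' h := by
  revert hc
  refine path_induction i (P := fun j h => (∀ l : Fin n, i ≤ l.castSucc → l.succ ≤ j → c l = c' l) →
    path x c h = path x c' h) ?_ (fun j h ih hc => ?_) j h
  · intro
    rw [path_self, path_self]
  · rw [← path_comp x c h (Fin.castSucc_le_succ j), ← path_comp x c' h (Fin.castSucc_le_succ j),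
      path_succ, path_succ, hc j h le_rfl,
      ih fun l hl hl' => hc l hl (hl'.trans (Fin.castSucc_le_succ j))]

lemma path_update_of_notMem {n : ℕ} [DecidableEq (Fin n)] (x : Fin (n + 1) → C)
    (c : ∀ i, Edges x i) (l : Fin n) (v : Edges x l) (i j : Fin (n + 1)) (h : i ≤ j)
    (hl : ¬ (i ≤ l.castSucc ∧ l.succ ≤ j)) :
    path x (Function.update c l v) h = path x c h :=
  path_congr x _ _ i j h fun l' h1 h2 => by
    rw [Function.update_of_ne]
    rintro rfl
    exact hl ⟨h1, h2⟩

lemma path_update_of_mem {n : ℕ} [DecidableEq (Fin n)] (x : Fin (n + 1) → C)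
    (c : ∀ i, Edges x i) (l : Fin n) (v : Edges x l) (i j : Fin (n + 1)) (h : i ≤ j)
    (h1 : i ≤ l.castSucc) (h2 : l.succ ≤ j) :
    path x (Function.update c l v) h = path x c h2 ≫ v ≫ path x c h1 := by
  rw [← path_comp _ _ (h1.trans (Fin.castSucc_le_succ l)) h2,
    ← path_comp _ _ h1 (Fin.castSucc_le_succ l), path_succ, Function.update_self,
    path_update_of_notMem x c l v _ _ h1, path_update_of_notMem x c l v _ _ h2]
  · rintro ⟨h3, -⟩
    exact absurd (Fin.castSucc_lt_succ (i := l)) (not_lt.2 h3)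
  · rintro ⟨-, h3⟩
    exact absurd (Fin.castSucc_lt_succ (i := l)) (not_lt.2 h3)

/-- A morphism of the family along `x` takes part in at most one morphism of the family along
`x ∘ θ`, or lies before the position `θ 0`, or after the last position in the image of `θ`. -/
lemma position_cases {m n : ℕ} (θ : Fin (m + 1) →o Fin (n + 1)) (l : Fin n) :
    l.succ ≤ θ 0 ∨ θ (Fin.last m) ≤ l.castSucc ∨
      ∃ a : Fin m, θ a.castSucc ≤ l.castSucc ∧ l.succ ≤ θ a.succ := by
  by_cases h1 : l.succ ≤ θ 0
  · exact Or.inl h1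
  by_cases h2 : l.succ ≤ θ (Fin.last m)
  · refine Or.inr (Or.inr ?_)
    have key : ∀ j : Fin (m + 1), l.succ ≤ θ j →
        ∃ a : Fin m, θ a.castSucc ≤ l.castSucc ∧ l.succ ≤ θ a.succ := by
      intro j
      induction j using Fin.induction with
      | zero => exact fun h => absurd h h1
      | succ j ih =>
        intro h
        by_cases h3 : l.succ ≤ θ j.castSucc
        · exact ih h3
        · exact ⟨j, Fin.le_castSucc_iff.2 (not_le.1 h3), h⟩
    exact key _ h2
  · exact Or.inr (Or.inl (Fin.le_castSucc_iff.2 (not_le.1 h2)))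

lemma not_succ_le {n : ℕ} (l : Fin n) : ¬ l.succ ≤ l.castSucc :=
  not_le.2 Fin.castSucc_lt_succ

lemma pull_update {m n : ℕ} [DecidableEq (Fin n)] [DecidableEq (Fin m)]
    (θ : Fin (m + 1) →o Fin (n + 1)) (x : Fin (n + 1) → C) (c : ∀ i, Edges x i) (l : Fin n)
    (a : Fin m) (h1 : θ a.castSucc ≤ l.castSucc) (h2 : l.succ ≤ θ a.succ) (v : Edges x l) :
    pull θ x (Function.update c l v) =
      Function.update (pull θ x c) a (path x c h2 ≫ v ≫ path x c h1) := by
  funext b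
  by_cases hb : b = a
  · subst hb
    rw [Function.update_self]
    exact path_update_of_mem x c l v _ _ _ h1 h2
  · rw [Function.update_of_ne hb]
    refine path_update_of_notMem x c l v _ _ _ ?_
    rintro ⟨h3, h4⟩
    rcases lt_or_gt_of_ne hb with h | h
    · have h5 : b.succ ≤ a.castSucc := Fin.succ_le_castSucc_iff.2 h
      exact not_succ_le l (h4.trans ((θ.monotone h5).trans h1))
    · have h5 : a.succ ≤ b.castSucc := Fin.succ_le_castSucc_iff.2 h
      exact not_succ_le l (h2.trans ((θ.monotone h5).trans h3))

end Paths

variable {k : Type u} [CommRing k] {C : Type u} [SmallCategory C] [Preadditive C] [Linear k C]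
  (M : Bimodule k C)

/-- The summand `_{x_1} M _{x_{n+1}} ⊗ _{x_{n+1}} C _{x_n} ⊗ ⋯ ⊗ _{x_2} C _{x_1}` of the chains in
degree `n`, with `x 0, …, x n` for `x_{n+1}, …, x_1`. -/
abbrev ChainTerm {n : ℕ} (x : Fin (n + 1) → C) : Type u :=
  M.obj (x (Fin.last n)) (x 0) ⊗[k] (⨂[k] i, Edges x i)

/-- The coefficient in `M` after multiplication by the morphisms of the family which lie before the
position `θ 0` (on the right) and after the last position in the image of `θ` (on the left). -/
def coeffMap {m n : ℕ} (θ : Fin (m + 1) →o Fin (n + 1)) (x : Fin (n + 1) → C)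
    (c : ∀ i, Edges x i) :
    M.obj (x (Fin.last n)) (x 0) →ₗ[k] M.obj ((x ∘ θ) (Fin.last m)) ((x ∘ θ) 0) :=
  M.lact (path x c (Fin.le_last (θ (Fin.last m)))) ∘ₗ M.ract (path x c (Fin.zero_le (θ 0)))

lemma coeffMap_apply {m n : ℕ} (θ : Fin (m + 1) →o Fin (n + 1)) (x : Fin (n + 1) → C)
    (c : ∀ i, Edges x i) (a : M.obj (x (Fin.last n)) (x 0)) :
    coeffMap M θ x c a = M.lact (path x c (Fin.le_last (θ (Fin.last m))))
      (M.ract (path x c (Fin.zero_le (θ 0))) a) :=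
  rfl

/-- The operator attached to `θ`, as a function of the family of morphisms. -/
def operatorFun {m n : ℕ} (θ : Fin (m + 1) →o Fin (n + 1)) (x : Fin (n + 1) → C)
    (c : ∀ i, Edges x i) : M.obj (x (Fin.last n)) (x 0) →ₗ[k] ChainTerm M (x ∘ θ) :=
  (TensorProduct.mk k (M.obj ((x ∘ θ) (Fin.last m)) ((x ∘ θ) 0)) (⨂[k] i, Edges (x ∘ θ) i)).flip
    (PiTensorProduct.tprod k (pull θ x c)) ∘ₗ coeffMap M θ x c

lemma operatorFun_apply {m n : ℕ} (θ : Fin (m + 1) →o Fin (n + 1)) (x : Fin (n + 1) → C)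
    (c : ∀ i, Edges x i) (a : M.obj (x (Fin.last n)) (x 0)) :
    operatorFun M θ x c a = coeffMap M θ x c a ⊗ₜ PiTensorProduct.tprod k (pull θ x c) :=
  rfl

lemma operatorFun_update {m n : ℕ} [DecidableEq (Fin n)] (θ : Fin (m + 1) →o Fin (n + 1))
    (x : Fin (n + 1) → C) (c : ∀ i, Edges x i) (l : Fin n) :
    ∃ L : Edges x l →ₗ[k] M.obj (x (Fin.last n)) (x 0) →ₗ[k] ChainTerm M (x ∘ θ),
      ∀ v, operatorFun M θ x (Function.update c l v) = L v := by
  have h0l : θ 0 ≤ θ (Fin.last m) := θ.monotone (Fin.zero_le _)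
  suffices h : (∀ v w a, operatorFun M θ x (Function.update c l (v + w)) a =
      operatorFun M θ x (Function.update c l v) a + operatorFun M θ x (Function.update c l w) a) ∧
      (∀ (r : k) v a, operatorFun M θ x (Function.update c l (r • v)) a =
        r • operatorFun M θ x (Function.update c l v) a) from
    ⟨{ toFun := fun v => operatorFun M θ x (Function.update c l v)
       map_add' := fun v w => LinearMap.ext (h.1 v w)
       map_smul' := fun r v => LinearMap.ext (h.2 r v) }, fun v => rfl⟩
  rcases position_cases θ l with h | h | ⟨a, h1, h2⟩
  · have hp (v) : pull θ x (Function.update c l v) = pull θ x c := funext fun b =>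
      path_update_of_notMem x c l v _ _ _ fun hb =>
        not_succ_le l (h.trans ((θ.monotone (Fin.zero_le _)).trans hb.1))
    have hl (v) : path x (Function.update c l v) (Fin.le_last (θ (Fin.last m))) =
        path x c (Fin.le_last (θ (Fin.last m))) :=
      path_update_of_notMem x c l v _ _ _ fun hb => not_succ_le l (h.trans (h0l.trans hb.1))
    have hr (v) := path_update_of_mem x c l v _ _ (Fin.zero_le (θ 0)) (Fin.zero_le _) h
    have hco (v a) : coeffMap M θ x (Function.update c l v) a =
        M.lact (path x c (Fin.le_last (θ (Fin.last m))))
          (M.ract (path x c h ≫ v ≫ path x c (Fin.zero_le _)) a) :=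
      congrArg₂ (fun p q => M.lact p (M.ract q a)) (hl v) (hr v)
    constructor
    · intro v w a
      have hadd : coeffMap M θ x (Function.update c l (v + w)) a =
          coeffMap M θ x (Function.update c l v) a + coeffMap M θ x (Function.update c l w) a :=
        (hco _ a).trans (Eq.trans (by simp) (congrArg₂ (· + ·) (hco v a).symm (hco w a).symm))
      rw [operatorFun_apply, operatorFun_apply, operatorFun_apply, hp, hp, hp, hadd,
        TensorProduct.add_tmul]
    · intro r v a
      have hsmul : coeffMap M θ x (Function.update c l (r • v)) a =
          r • coeffMap M θ x (Function.update c l v) a :=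
        (hco _ a).trans (Eq.trans (by simp) (congrArg (r • ·) (hco v a).symm))
      rw [operatorFun_apply, operatorFun_apply, hp, hp, hsmul, TensorProduct.smul_tmul']
  · have hp (v) : pull θ x (Function.update c l v) = pull θ x c := funext fun b =>
      path_update_of_notMem x c l v _ _ _ fun hb =>
        not_succ_le l (hb.2.trans ((θ.monotone (Fin.le_last _)).trans h))
    have hr (v) : path x (Function.update c l v) (Fin.zero_le (θ 0)) =
        path x c (Fin.zero_le (θ 0)) :=
      path_update_of_notMem x c l v _ _ _ fun hb => not_succ_le l (hb.2.trans (h0l.trans h))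
    have hl (v) := path_update_of_mem x c l v _ _ (Fin.le_last (θ (Fin.last m))) h (Fin.le_last _)
    have hco (v a) : coeffMap M θ x (Function.update c l v) a =
        M.lact (path x c (Fin.le_last _) ≫ v ≫ path x c h)
          (M.ract (path x c (Fin.zero_le (θ 0))) a) :=
      congrArg₂ (fun p q => M.lact p (M.ract q a)) (hl v) (hr v)
    constructor
    · intro v w a
      have hadd : coeffMap M θ x (Function.update c l (v + w)) a =
          coeffMap M θ x (Function.update c l v) a + coeffMap M θ x (Function.update c l w) a :=
        (hco _ a).trans (Eq.trans (by simp) (congrArg₂ (· + ·) (hco v a).symm (hco w a).symm))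
      rw [operatorFun_apply, operatorFun_apply, operatorFun_apply, hp, hp, hp, hadd,
        TensorProduct.add_tmul]
    · intro r v a
      have hsmul : coeffMap M θ x (Function.update c l (r • v)) a =
          r • coeffMap M θ x (Function.update c l v) a :=
        (hco _ a).trans (Eq.trans (by simp) (congrArg (r • ·) (hco v a).symm))
      rw [operatorFun_apply, operatorFun_apply, hp, hp, hsmul, TensorProduct.smul_tmul']
  · have hp (v) := pull_update θ x c l a h1 h2 v
    have hr (v) : path x (Function.update c l v) (Fin.zero_le (θ 0)) =
        path x c (Fin.zero_le (θ 0)) :=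
      path_update_of_notMem x c l v _ _ _ fun hb =>
        not_succ_le l (hb.2.trans ((θ.monotone (Fin.zero_le _)).trans h1))
    have hl (v) : path x (Function.update c l v) (Fin.le_last (θ (Fin.last m))) =
        path x c (Fin.le_last (θ (Fin.last m))) :=
      path_update_of_notMem x c l v _ _ _ fun hb =>
        not_succ_le l (h2.trans ((θ.monotone (Fin.le_last _)).trans hb.1))
    have hco (v) : coeffMap M θ x (Function.update c l v) = coeffMap M θ x c :=
      congrArg₂ (fun p q => M.lact p ∘ₗ M.ract q) (hl v) (hr v)
    constructor <;> intros <;>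
      simp [operatorFun_apply, hp, hco, TensorProduct.tmul_add, TensorProduct.tmul_smul]

/-- The operator attached to `θ`, as a multilinear function of the family of morphisms. -/
def operatorMultilinear {m n : ℕ} (θ : Fin (m + 1) →o Fin (n + 1)) (x : Fin (n + 1) → C) :
    MultilinearMap k (Edges x) (M.obj (x (Fin.last n)) (x 0) →ₗ[k] ChainTerm M (x ∘ θ)) where
  toFun c := operatorFun M θ x c
  map_update_add' c l v w := by
    obtain ⟨L, hL⟩ := operatorFun_update M θ x c l
    simp only [hL, map_add]
  map_update_smul' c l r v := by
    obtain ⟨L, hL⟩ := operatorFun_update M θ x c l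
    simp only [hL, map_smul]

/-- The operator attached to `θ` on the summand of the sequence `x`. -/
def operatorTerm {m n : ℕ} (θ : Fin (m + 1) →o Fin (n + 1)) (x : Fin (n + 1) → C) :
    ChainTerm M x →ₗ[k] ChainTerm M (x ∘ θ) :=
  TensorProduct.lift (PiTensorProduct.lift (operatorMultilinear M θ x)).flip

lemma operatorTerm_tmul {m n : ℕ} (θ : Fin (m + 1) →o Fin (n + 1)) (x : Fin (n + 1) → C)
    (a : M.obj (x (Fin.last n)) (x 0)) (c : ∀ i, Edges x i) :
    operatorTerm M θ x (a ⊗ₜ PiTensorProduct.tprod k c) =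
      coeffMap M θ x c a ⊗ₜ PiTensorProduct.tprod k (pull θ x c) := by
  simp only [operatorTerm, TensorProduct.lift.tmul, LinearMap.flip_apply,
    PiTensorProduct.lift.tprod]
  rfl

/-- The module of Hochschild–Mitchell chains in degree `n`: the direct sum of the modules `ChainTerm M x`
over all sequences `x` of `n + 1` objects. -/
abbrev Chains (n : ℕ) : Type u := DirectSum (Fin (n + 1) → C) (fun x => ChainTerm M x)

open scoped Classical

/-- The generator `a ⊗ c_n ⊗ ⋯ ⊗ c_1` of the module of chains. -/
def gen {n : ℕ} (x : Fin (n + 1) → C) (a : M.obj (x (Fin.last n)) (x 0)) (c : ∀ i, Edges x i) :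
    Chains M n :=
  DirectSum.lof k (Fin (n + 1) → C) (fun x => ChainTerm M x) x (a ⊗ₜ PiTensorProduct.tprod k c)

lemma chains_ext {n : ℕ} {N : Type u} [AddCommGroup N] [Module k N] {f g : Chains M n →ₗ[k] N}
    (h : ∀ x a c, f (gen M x a c) = g (gen M x a c)) : f = g := by
  refine DirectSum.linearMap_ext _ fun x => TensorProduct.ext' fun a t => ?_
  induction t using PiTensorProduct.induction_on with
  | smul_tprod r c =>
    rw [TensorProduct.tmul_smul, map_smul, map_smul]
    exact congrArg (r • ·) (h x a c)
  | add t t' ht ht' => rw [TensorProduct.tmul_add, map_add, map_add, ht, ht']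

lemma gen_congr {n : ℕ} {x x' : Fin (n + 1) → C} (hx : x = x')
    {a : M.obj (x (Fin.last n)) (x 0)} {a' : M.obj (x' (Fin.last n)) (x' 0)} (ha : HEq a a')
    {c : ∀ i, Edges x i} {c' : ∀ i, Edges x' i} (hc : ∀ i, HEq (c i) (c' i)) :
    gen M x a c = gen M x' a' c' := by
  subst hx
  cases ha
  obtain rfl : c = c' := funext fun i => eq_of_heq (hc i)
  rfl

/-- The simplicial operator attached to `θ` on chains. It sends `a ⊗ c_n ⊗ ⋯ ⊗ c_1` to the element
obtained by composing the morphisms between consecutive positions in the image of `θ`, and by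
letting the remaining ones act on `a`: those on the left of the image act on the right of `a`, those
on the right of the image act on the left of `a`. If `θ` omits a single position `i`, this is the
`i`-th Hochschild face: `a c_n ⊗ c_{n-1} ⊗ ⋯ ⊗ c_1` for `i = 0`,
`c_1 a ⊗ c_n ⊗ ⋯ ⊗ c_2` for `i = n`, and
`a ⊗ c_n ⊗ ⋯ ⊗ c_{n-i+1} c_{n-i} ⊗ ⋯ ⊗ c_1` for `0 < i < n`. -/
def operator {m n : ℕ} (θ : Fin (m + 1) →o Fin (n + 1)) : Chains M n →ₗ[k] Chains M m :=
  DirectSum.toModule k _ _ fun x =>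
    DirectSum.lof k (Fin (m + 1) → C) (fun x => ChainTerm M x) (x ∘ θ) ∘ₗ operatorTerm M θ x

lemma operator_gen {m n : ℕ} (θ : Fin (m + 1) →o Fin (n + 1)) (x : Fin (n + 1) → C)
    (a : M.obj (x (Fin.last n)) (x 0)) (c : ∀ i, Edges x i) :
    operator M θ (gen M x a c) = gen M (x ∘ θ) (coeffMap M θ x c a) (pull θ x c) := by
  rw [operator, gen, DirectSum.toModule_lof, LinearMap.comp_apply, operatorTerm_tmul]
  rfl

lemma operator_id (n : ℕ) : operator M (OrderHom.id : Fin (n + 1) →o Fin (n + 1)) = .id := by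
  refine chains_ext M fun x a c => ?_
  rw [operator_gen, LinearMap.id_apply]
  refine gen_congr M rfl (heq_of_eq ?_) fun i => heq_of_eq (path_succ x c i)
  rw [coeffMap_apply]
  exact (congrArg₂ (fun p q => M.lact p (M.ract q a)) (path_self x c _) (path_self x c _)).trans
    ((M.lact_id _).trans (M.ract_id _))

lemma operator_comp {l m n : ℕ} (φ : Fin (l + 1) →o Fin (m + 1)) (θ : Fin (m + 1) →o Fin (n + 1)) :
    operator M (θ.comp φ) = operator M φ ∘ₗ operator M θ := by
  refine chains_ext M fun x a c => ?_
  rw [LinearMap.comp_apply, operator_gen, operator_gen, operator_gen]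
  refine gen_congr M rfl (heq_of_eq ?_) fun i =>
    heq_of_eq (path_pull θ x c _ _ (φ.monotone (Fin.castSucc_le_succ i))).symm
  rw [coeffMap_apply, coeffMap_apply, coeffMap_apply, path_pull, path_pull, ← M.lact_ract,
    M.ract_ract, M.lact_lact]
  exact congrArg₂ (fun p q => M.lact p (M.ract q a)) (path_comp x c _ _).symm
    (path_comp x c _ _).symm

/-- The simplicial module of Hochschild–Mitchell chains. -/
def simplicialChains : SimplicialObject (ModuleCat.{u} k) where
  obj Δ := ModuleCat.of k (Chains M Δ.unop.len)
  map f := ModuleCat.ofHom (operator M f.unop.toOrderHom)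
  map_id Δ := ModuleCat.hom_ext (operator_id M Δ.unop.len)
  map_comp f g := ModuleCat.hom_ext (operator_comp M g.unop.toOrderHom f.unop.toOrderHom)

/-- The Hochschild–Mitchell chain complex `C_•(C, M)`, whose differential is the alternating sum of
the Hochschild faces. -/
def chainComplex : ChainComplex (ModuleCat.{u} k) ℕ :=
  (AlgebraicTopology.alternatingFaceMapComplex _).obj (simplicialChains M)

/-- The Hochschild–Mitchell homology `H_n(C, M)`. -/
def homology (n : ℕ) : ModuleCat.{u} k := (chainComplex M).homology n

/-- The differential is the alternating sum of the Hochschild faces. -/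
lemma chainComplex_d_gen (n : ℕ) (x : Fin (n + 2) → C) (a : M.obj (x (Fin.last (n + 1))) (x 0))
    (c : ∀ i, Edges x i) :
    (chainComplex M).d (n + 1) n (gen M x a c) = ∑ i : Fin (n + 2), (-1 : ℤ) ^ (i : ℕ) •
      gen M (x ∘ (Fin.succAboveOrderEmb i).toOrderHom)
        (coeffMap M (Fin.succAboveOrderEmb i).toOrderHom x c a)
        (pull (Fin.succAboveOrderEmb i).toOrderHom x c) := by
  simp only [chainComplex, AlgebraicTopology.alternatingFaceMapComplex_obj_d,
    AlgebraicTopology.AlternatingFaceMapComplex.objD]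
  change (ModuleCat.Hom.hom _) _ = _
  rw [ModuleCat.hom_sum]
  erw [LinearMap.sum_apply]
  refine Finset.sum_congr rfl fun i _ => ?_
  erw [ModuleCat.hom_zsmul]
  exact congrArg (((-1 : ℤ) ^ (i : ℕ)) • ·)
    (operator_gen M (Fin.succAboveOrderEmb i).toOrderHom x a c)

end Chains

section Action

variable {k : Type u} [CommRing k] {G : Type u} [Group G] {C : Type u} [SmallCategory C]
  [Preadditive C] [Linear k C] [MulAction G C]

namespace FreeAction

variable (A : FreeAction k G C)

/-- The bimodule over `C` lifted from a bimodule over the quotient category. -/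
abbrev liftedBimodule (M : Bimodule k A.QuotientCategory) : Bimodule k C := M.lift A.proj

/-- The translate of a family of composable morphisms. -/
def edgesMap (s : G) {n : ℕ} (x : Fin (n + 1) → C) (i : Fin n) :
    Edges x i →ₗ[k] Edges (s • x) i :=
  A.map s

lemma path_edgesMap (s : G) {n : ℕ} (x : Fin (n + 1) → C) (c : ∀ i, Edges x i) (i j : Fin (n + 1))
    (h : i ≤ j) : path (s • x) (fun l => A.edgesMap s x l (c l)) h = A.map s (path x c h) := by
  refine path_induction i
    (P := fun j h => path (s • x) (fun l => A.edgesMap s x l (c l)) h = A.map s (path x c h))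
    ?_ (fun j h ih => ?_) j h
  · rw [path_self, path_self]
    exact (A.map_id s (x i)).symm
  · rw [← path_comp (s • x) _ h (Fin.castSucc_le_succ j), ← path_comp x c h (Fin.castSucc_le_succ j),
      path_succ, path_succ, ih]
    exact (A.map_comp s _ _).symm

variable (M : Bimodule k A.QuotientCategory)

/-- The identification of `_y (LM) _x` with `_{s y} (LM) _{s x}`: both are the value of `M` at the
orbits of `y` and `x`. -/
def liftedEquiv (s : G) (y x : C) :
    (A.liftedBimodule M).obj y x ≃ₗ[k] (A.liftedBimodule M).obj (s • y) (s • x) :=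
  M.castEquiv (A.toQuotient_smul s y).symm (A.toQuotient_smul s x).symm

lemma liftedEquiv_heq (s : G) (y x : C) (a : (A.liftedBimodule M).obj y x) :
    HEq (A.liftedEquiv M s y x a) a :=
  M.castEquiv_heq _ _ a

lemma liftedEquiv_lact (s : G) {x y z : C} (c : y ⟶ z) (a : (A.liftedBimodule M).obj y x) :
    (A.liftedBimodule M).lact (A.map s c) (A.liftedEquiv M s y x a) =
      A.liftedEquiv M s z x ((A.liftedBimodule M).lact c a) :=
  M.lact_castEquiv _ _ _ (A.proj_map_smul s c).symm a

lemma liftedEquiv_ract (s : G) {x y z : C} (c : z ⟶ x) (a : (A.liftedBimodule M).obj y x) :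
    (A.liftedBimodule M).ract (A.map s c) (A.liftedEquiv M s y x a) =
      A.liftedEquiv M s y z ((A.liftedBimodule M).ract c a) :=
  M.ract_castEquiv _ _ _ (A.proj_map_smul s c).symm a

open scoped Classical

/-- The action of `s` on the chains with coefficients in the lifted bimodule: it sends
`a ⊗ c_n ⊗ ⋯ ⊗ c_1` to `a ⊗ s c_n ⊗ ⋯ ⊗ s c_1`. -/
def chainsMap (s : G) (n : ℕ) :
    Chains (A.liftedBimodule M) n →ₗ[k] Chains (A.liftedBimodule M) n :=
  DirectSum.toModule k _ _ fun x =>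
    DirectSum.lof k (Fin (n + 1) → C) (fun x => ChainTerm (A.liftedBimodule M) x) (s • x) ∘ₗ
      TensorProduct.map (A.liftedEquiv M s (x (Fin.last n)) (x 0)).toLinearMap
        (PiTensorProduct.map (A.edgesMap s x))

lemma chainsMap_gen (s : G) {n : ℕ} (x : Fin (n + 1) → C)
    (a : (A.liftedBimodule M).obj (x (Fin.last n)) (x 0)) (c : ∀ i, Edges x i) :
    A.chainsMap M s n (gen (A.liftedBimodule M) x a c) =
      gen (A.liftedBimodule M) (s • x) (A.liftedEquiv M s _ _ a)
        (fun i => A.edgesMap s x i (c i)) := by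
  rw [chainsMap, gen, DirectSum.toModule_lof, LinearMap.comp_apply, TensorProduct.map_tmul,
    PiTensorProduct.map_tprod]
  rfl

lemma chainsMap_one (n : ℕ) : A.chainsMap M 1 n = .id := by
  refine chains_ext _ fun x a c => ?_
  rw [chainsMap_gen]
  exact gen_congr _ (one_smul G x) (A.liftedEquiv_heq M 1 _ _ a) fun i => A.map_one (c i)

lemma chainsMap_mul (s t : G) (n : ℕ) :
    A.chainsMap M (s * t) n = A.chainsMap M s n ∘ₗ A.chainsMap M t n := by
  refine chains_ext _ fun x a c => ?_
  rw [LinearMap.comp_apply, chainsMap_gen, chainsMap_gen, chainsMap_gen]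
  exact gen_congr _ (mul_smul s t x) ((A.liftedEquiv_heq M _ _ _ a).trans
    ((A.liftedEquiv_heq M s _ _ _).trans (A.liftedEquiv_heq M t _ _ a)).symm)
    fun i => A.map_mul s t (c i)

lemma chainsMap_operator (s : G) {m n : ℕ} (θ : Fin (m + 1) →o Fin (n + 1)) :
    A.chainsMap M s m ∘ₗ operator (A.liftedBimodule M) θ =
      operator (A.liftedBimodule M) θ ∘ₗ A.chainsMap M s n := by
  refine chains_ext _ fun x a c => ?_
  rw [LinearMap.comp_apply, LinearMap.comp_apply, chainsMap_gen, operator_gen, operator_gen,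
    chainsMap_gen]
  refine gen_congr _ rfl (heq_of_eq ?_) fun i => heq_of_eq (A.path_edgesMap s x c _ _ _).symm
  rw [coeffMap_apply, coeffMap_apply, path_edgesMap, path_edgesMap]
  exact ((congrArg _ (A.liftedEquiv_ract M s _ a)).trans (A.liftedEquiv_lact M s _ _)).symm

/-- The action of `G` on the simplicial module of chains with coefficients in the lifted bimodule. -/
def simplicialAction : G →* End (simplicialChains (A.liftedBimodule M)) where
  toFun s :=
    { app := fun Δ => ModuleCat.ofHom (A.chainsMap M s Δ.unop.len)
      naturality := fun _ _ f =>
        ModuleCat.hom_ext (A.chainsMap_operator M s f.unop.toOrderHom) }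
  map_one' := NatTrans.ext (funext fun Δ => ModuleCat.hom_ext (A.chainsMap_one M Δ.unop.len))
  map_mul' s t :=
    NatTrans.ext (funext fun Δ => ModuleCat.hom_ext (A.chainsMap_mul M s t Δ.unop.len))

/-- The action of `G` on the Hochschild–Mitchell chain complex `C_•(C, LM)`. -/
def chainAction : G →* End (chainComplex (A.liftedBimodule M)) :=
  ((AlgebraicTopology.alternatingFaceMapComplex _).mapEnd _).comp (A.simplicialAction M)

/-- The representation of `G` on the Hochschild–Mitchell homology `H_q(C, LM)`. -/
def homologyRep (q : ℕ) : Rep.{u} k G :=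
  Rep.of (X := homology (A.liftedBimodule M) q)
    ((ModuleCat.endRingEquiv _).toMonoidHom.comp
      (((HomologicalComplex.homologyFunctor (ModuleCat.{u} k) (ComplexShape.down ℕ) q).mapEnd
        _).comp (A.chainAction M)))

end FreeAction

end Action

section SpectralSequences

variable {k : Type u} [CommRing k]

/-- First quadrant homological spectral sequences of `k`-modules, from the second page on: the
differential of the page `r` maps the position `(p, q)` to the position `(p - r, q + r - 1)`. -/
abbrev FirstQuadrantSpectralSequence (k : Type u) [CommRing k] : Type (u + 1) :=
  SpectralSequence (ModuleCat.{u} k)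
    (fun r => ComplexShape.spectralSequenceNat (⟨-r, r - 1⟩ : ℤ × ℤ)) 2

/-- The term `E^r_{p,q}` of a spectral sequence. -/
def pageTerm (E : FirstQuadrantSpectralSequence k) (r : ℤ) (hr : 2 ≤ r) (p q : ℕ) : ModuleCat.{u} k :=
  (E.page r hr).X (p, q)

/-- The term `E^∞_{p,q}` of a first quadrant spectral sequence: all the differentials from and to
the position `(p, q)` vanish from the page `p + q + 2` on, so that the terms at `(p, q)` of the
later pages are identified with that of the page `p + q + 2`. -/
def termInfty (E : FirstQuadrantSpectralSequence k) (p q : ℕ) : ModuleCat.{u} k :=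
  pageTerm E (p + q + 2) (by lia) p q

/-- A first quadrant spectral sequence converges to the modules `H n` if every `H n` has an
increasing filtration `0 = F_{-1} ⊆ F_0 ⊆ ⋯ ⊆ F_n = H n` with `F_p / F_{p-1}` isomorphic to
`E^∞_{p,n-p}` for `0 ≤ p ≤ n`. -/
def ConvergesTo (E : FirstQuadrantSpectralSequence k) (H : ℕ → ModuleCat.{u} k) : Prop :=
  ∀ n : ℕ, ∃ F : ℤ → Submodule k (H n), Monotone F ∧ F (-1) = ⊥ ∧ F n = ⊤ ∧
    ∀ p q : ℕ, p + q = n →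
      Nonempty ((F p ⧸ (F (p - 1)).submoduleOf (F p)) ≃ₗ[k] termInfty E p q)

end SpectralSequences

end

end CartanLeray

/-!
Let `K = C_•(C, LM)`, a complex of `kG`-modules. Both sides of the theorem are read off the double
complex `X_{p,q} = k[G^p] ⊗ K_q` of inhomogeneous chains of `G` with coefficients in `K`.

Filter the total complex by `p`. A filtered complex of modules, bounded as in `ChainFiltration`, has a
spectral sequence with pages `E^r_p = (F_p ∩ d⁻¹ F_{p-r}) / (F_{p-1} + d F_{p+r-1})` (the denominator
being intersected with the numerator), which converges to the homology of the complex
(`ChainFiltration.convergesTo`). For a double complex the second page is the horizontal homology of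
the vertical homology (`DoubleComplex.secondPageIso`). The functors `k[G^p] ⊗ -` are exact, so the
vertical homology of `X` consists of the inhomogeneous chains with coefficients in `H_q(K)`, whose
homology is `H_p(G, H_q(K))` (`exists_hyperhomology_spectralSequence`).

It remains to see that the total complex computes `H_•(B, M)`. As `G` acts freely on the objects of
`C`, each `K_q` is induced from the trivial subgroup: it is graded by `G`, a chain on the sequence of
objects `x` having as degree the element of `G` which moves `x 0` to the chosen object of its orbit
(`FreeAction.freeGrading`). Such a grading yields a contraction of the inhomogeneous chains
(`FreeGrading.contraction`), so the rows of the double complex are exact in positive degrees, and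
their homology in degree `0` is the module of coinvariants of `K_q`. The projection `C → B` maps `K_q`
onto `C_q(B, M)`, because a morphism of `B` is a sum of classes of morphisms of `C` starting at a given
object (`FreeAction.chainsImage_surjective`). It induces an isomorphism on coinvariants: a morphism of
`B` is a `G`-invariant family of morphisms of `C`, so a chain of `B` has a coordinate at each sequence
of objects of `C`, and those at the sequences of degree `1` are the components of the translate into
degree `1` of any chain above it (`FreeAction.component_orbitRetract`). Hence the rows,
augmented by `C_q(B, M)`, are exact, and the total complex has the homology of `C_•(B, M)`
(`DoubleComplex.homologyIsoOfAugmentation`, `FreeAction.totalHomologyIso`).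
-/

namespace CartanLeray
noncomputable section

/-! ### The spectral sequence of a filtered complex -/

section FilteredComplex

variable {k : Type u} [CommRing k]

/-- The homology of a complex of modules at `i`, computed from a linear map `f : Z → K_i` which takes
values in cycles and meets every homology class; the submodule `N` consists of the elements that
`f` sends to boundaries. -/
def homologyIsoQuotient {ι : Type*} {c : ComplexShape ι} (K : HomologicalComplex (ModuleCat.{u} k) c)
    (i : ι) {Z : Type u} [AddCommGroup Z] [Module k Z] (f : Z →ₗ[k] K.X i) (N : Submodule k Z)
    (hcycle : ∀ z j, K.d i j (f z) = 0)
    (hsurj : ∀ x : K.X i, (∀ j, K.d i j x = 0) → ∃ (z : Z) (j : ι) (y : K.X j), x = f z + K.d j i y)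
    (hN : ∀ z, z ∈ N ↔ ∃ (j : ι) (y : K.X j), K.d j i y = f z) :
    K.homology i ≅ ModuleCat.of k (Z ⧸ N) := by
  have hprev (j : ι) (y : K.X j) : ∃ y' : K.X (c.prev i), K.d (c.prev i) i y' = K.d j i y := by
    by_cases h : c.Rel j i
    · obtain rfl := c.prev_eq' h
      exact ⟨y, rfl⟩
    · exact ⟨0, by simp [K.shape _ _ h]⟩
  have hnext (x : K.X i) (h : K.d i (c.next i) x = 0) (j : ι) : K.d i j x = 0 := by
    by_cases h' : c.Rel i j
    · obtain rfl := c.next_eq' h'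
      exact h
    · simp [K.shape _ _ h']
  let φ : Z →ₗ[k] LinearMap.ker (K.sc i).g.hom := f.codRestrict _ fun z => hcycle z _
  let ψ : Z →ₗ[k] (K.sc i).moduleCatLeftHomologyData.H :=
    (LinearMap.range (K.sc i).moduleCatToCycles).mkQ ∘ₗ φ
  have hker : LinearMap.ker ψ = N := by
    ext z
    rw [hN, LinearMap.mem_ker]
    refine (Submodule.Quotient.mk_eq_zero _).trans ⟨?_, ?_⟩
    · rintro ⟨y, hy⟩
      exact ⟨_, y, congrArg Subtype.val hy⟩
    · rintro ⟨j, y, hy⟩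
      obtain ⟨y', hy'⟩ := hprev j y
      exact ⟨y', Subtype.ext (hy'.trans hy)⟩
  have hsur : Function.Surjective ψ := by
    intro a
    obtain ⟨⟨x, hx⟩, rfl⟩ := Submodule.Quotient.mk_surjective _ a
    obtain ⟨z, j, y, rfl⟩ := hsurj x (hnext x hx)
    obtain ⟨y', hy'⟩ := hprev j y
    refine ⟨z, ((Submodule.Quotient.eq _).2 ?_)⟩
    refine ⟨-y', Subtype.ext ?_⟩
    change K.d (c.prev i) i (-y') = f z - (f z + K.d j i y)
    rw [map_neg, hy']
    abel
  exact (K.sc i).moduleCatHomologyIso ≪≫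
    (((Submodule.quotEquivOfEq _ _ hker.symm).trans
      (ψ.quotKerEquivOfSurjective hsur)).toModuleIso).symm

/-- An increasing filtration `⋯ ⊆ F_p ⊆ F_{p+1} ⊆ ⋯` of a chain complex of modules, with
`F_p K_n = 0` for `p < 0` and `F_p K_n = K_n` for `p ≥ n`. -/
structure ChainFiltration (K : ChainComplex (ModuleCat.{u} k) ℕ) where
  F : ℤ → ∀ n : ℕ, Submodule k (K.X n)
  mono {p p' : ℤ} (h : p ≤ p') (n : ℕ) : F p n ≤ F p' n
  d_mem {p : ℤ} {n : ℕ} {x : K.X n} (hx : x ∈ F p n) (m : ℕ) : K.d n m x ∈ F p m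
  eq_zero {p : ℤ} (hp : p < 0) {n : ℕ} {x : K.X n} (hx : x ∈ F p n) : x = 0
  mem_of_le {p : ℤ} {n : ℕ} (hp : n ≤ p) (x : K.X n) : x ∈ F p n

namespace ChainFiltration

variable {K : ChainComplex (ModuleCat.{u} k) ℕ} (F : ChainFiltration K)

lemma d_d (l m n : ℕ) (x : K.X l) : K.d m n (K.d l m x) = 0 := by
  rw [← ConcreteCategory.comp_apply, K.d_comp_d]
  rfl

/-- The elements of `F_p` whose boundary lies in `F_{p-r}`. -/
def Z (r p : ℤ) (n : ℕ) : Submodule k (K.X n) :=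
  F.F p n ⊓ ⨅ m, (F.F (p - r) m).comap (K.d n m).hom

lemma mem_Z {r p : ℤ} {n : ℕ} {x : K.X n} :
    x ∈ F.Z r p n ↔ x ∈ F.F p n ∧ ∀ m, K.d n m x ∈ F.F (p - r) m := by
  simp only [Z, Submodule.mem_inf, Submodule.mem_iInf, Submodule.mem_comap]

/-- The submodule `F_{p-1} + d F_{p+r-1}`. -/
def B (r p : ℤ) (n : ℕ) : Submodule k (K.X n) :=
  F.F (p - 1) n ⊔ (F.F (p + r - 1) (n + 1)).map (K.d (n + 1) n).hom

lemma mem_B {r p : ℤ} {n : ℕ} {x : K.X n} :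
    x ∈ F.B r p n ↔ ∃ w ∈ F.F (p - 1) n, ∃ y ∈ F.F (p + r - 1) (n + 1), w + K.d (n + 1) n y = x := by
  simp only [B, Submodule.mem_sup, Submodule.mem_map, exists_exists_and_eq_and]

/-- The term `E^r_p` in total degree `n`, as the quotient of `F_p ∩ d⁻¹ F_{p-r}` by its intersection
with `F_{p-1} + d F_{p+r-1}`. -/
abbrev E (r p : ℤ) (n : ℕ) : Type u := F.Z r p n ⧸ (F.B r p n).submoduleOf (F.Z r p n)

/-- The class of an element in `E^r_p`. -/
abbrev mkE {r p : ℤ} {n : ℕ} (x : K.X n) (hx : x ∈ F.Z r p n) : F.E r p n :=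
  Submodule.Quotient.mk ⟨x, hx⟩

lemma mkE_eq_zero {r p : ℤ} {n : ℕ} (x : K.X n) (hx : x ∈ F.Z r p n) :
    F.mkE x hx = 0 ↔ x ∈ F.B r p n := by
  rw [Submodule.Quotient.mk_eq_zero]
  rfl

lemma mkE_eq_mkE {r p : ℤ} {n : ℕ} (x y : K.X n) (hx : x ∈ F.Z r p n) (hy : y ∈ F.Z r p n) :
    F.mkE x hx = F.mkE y hy ↔ x - y ∈ F.B r p n := by
  rw [Submodule.Quotient.eq]
  rfl

lemma d_mem_Z {r p p' : ℤ} (hp : p' = p - r) {n : ℕ} {x : K.X n} (hx : x ∈ F.Z r p n) (m : ℕ) :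
    K.d n m x ∈ F.Z r p' m := by
  subst hp
  refine F.mem_Z.2 ⟨(F.mem_Z.1 hx).2 m, fun l => ?_⟩
  rw [d_d]
  exact zero_mem _

lemma d_mem_B {r p p' : ℤ} (hp : p' = p - r) {n : ℕ} {x : K.X n} (hx : x ∈ F.B r p n) (m : ℕ) :
    K.d n m x ∈ F.B r p' m := by
  obtain ⟨w, hw, y, -, rfl⟩ := F.mem_B.1 hx
  subst hp
  rw [map_add, d_d, add_zero]
  by_cases h : (ComplexShape.down ℕ).Rel n m
  · obtain rfl : m + 1 = n := h
    exact F.mem_B.2 ⟨0, zero_mem _, w, by simpa using hw, by simp⟩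
  · rw [K.shape _ _ h]
    exact zero_mem _

/-- The differential `E^r_p → E^r_{p-r}` induced by the differential of the complex. -/
def dE {r p p' : ℤ} (hp : p' = p - r) (n m : ℕ) : F.E r p n →ₗ[k] F.E r p' m :=
  Submodule.mapQ _ _ ((K.d n m).hom.restrict fun _ hx => F.d_mem_Z hp hx m)
    fun _ hx => F.d_mem_B hp hx m

lemma dE_mkE {r p p' : ℤ} (hp : p' = p - r) {n : ℕ} (m : ℕ) (x : K.X n) (hx : x ∈ F.Z r p n) :
    F.dE hp n m (F.mkE x hx) = F.mkE (K.d n m x) (F.d_mem_Z hp hx m) :=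
  rfl

/-- The pages of the spectral sequence of a filtered complex. -/
def page (r : ℤ) :
    HomologicalComplex (ModuleCat.{u} k) (ComplexShape.spectralSequenceNat (⟨-r, r - 1⟩ : ℤ × ℤ)) where
  X pq := ModuleCat.of k (F.E r pq.1 (pq.1 + pq.2))
  d pq pq' := by
    classical
    exact if h : (ComplexShape.spectralSequenceNat (⟨-r, r - 1⟩ : ℤ × ℤ)).Rel pq pq' then
      ModuleCat.ofHom (F.dE h.1.symm (pq.1 + pq.2) (pq'.1 + pq'.2)) else 0
  shape _ _ h := dif_neg h
  d_comp_d' a b c hab hbc := by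
    rw [dif_pos hab, dif_pos hbc]
    refine ModuleCat.hom_ext (LinearMap.ext fun a => ?_)
    obtain ⟨⟨x, hx⟩, rfl⟩ := Submodule.Quotient.mk_surjective _ a
    change F.dE hbc.1.symm _ _ (F.dE hab.1.symm _ _ (F.mkE x hx)) = 0
    rw [dE_mkE, dE_mkE, mkE_eq_zero, d_d]
    exact zero_mem _

lemma page_d_mkE (r : ℤ) (a b : ℕ × ℕ)
    (h : (ComplexShape.spectralSequenceNat (⟨-r, r - 1⟩ : ℤ × ℤ)).Rel a b) (x : K.X (a.1 + a.2))
    (hx : x ∈ F.Z r a.1 (a.1 + a.2)) :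
    (F.page r).d a b (F.mkE x hx) = F.mkE (K.d _ _ x) (F.d_mem_Z h.1.symm hx _) := by
  have : (F.page r).d a b = ModuleCat.ofHom (F.dE h.1.symm (a.1 + a.2) (b.1 + b.2)) := dif_pos h
  rw [this]
  rfl

lemma Z_anti (r p : ℤ) (n : ℕ) : F.Z (r + 1) p n ≤ F.Z r p n := fun x hx => by
  rw [mem_Z] at hx ⊢
  exact ⟨hx.1, fun m => F.mono (by lia) m (hx.2 m)⟩

lemma exists_sub_mem_Z {r p : ℤ} {n n' : ℕ} (hn : n' + 1 = n) {x : K.X n} (hx : x ∈ F.Z r p n)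
    (h : K.d n n' x ∈ F.B r (p - r) n') : ∃ w ∈ F.F (p - 1) n, x - w ∈ F.Z (r + 1) p n := by
  subst hn
  obtain ⟨v, hv, y, hy, hvy⟩ := F.mem_B.1 h
  refine ⟨y, F.mono (by lia) _ hy, F.mem_Z.2 ⟨?_, fun m => ?_⟩⟩
  · exact sub_mem (F.mem_Z.1 hx).1 (F.mono (by lia) _ hy)
  · by_cases hm : (ComplexShape.down ℕ).Rel (n' + 1) m
    · obtain rfl : m = n' := Nat.succ.inj hm
      rw [map_sub, ← hvy, add_sub_cancel_right]
      exact F.mono (by lia) _ hv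
    · rw [K.shape _ _ hm]
      exact zero_mem _

/-- A cycle of the page `r` is represented by an element of `F_p` with boundary in `F_{p-r-1}`. -/
lemma exists_mem_Z_succ (r : ℤ) (hr : 2 ≤ r) (a : ℕ × ℕ) (x : K.X (a.1 + a.2))
    (hx : x ∈ F.Z r a.1 (a.1 + a.2)) (h : ∀ b, (F.page r).d a b (F.mkE x hx) = 0) :
    ∃ w ∈ F.F (a.1 - 1) (a.1 + a.2), x - w ∈ F.Z (r + 1) a.1 (a.1 + a.2) := by
  obtain ⟨p, q⟩ := a
  dsimp only at x hx ⊢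
  have hxF := F.mem_Z.1 hx
  by_cases hpr : r ≤ p
  · let b : ℕ × ℕ := ((p - r).toNat, (q + r - 1).toNat)
    have hb : (ComplexShape.spectralSequenceNat (⟨-r, r - 1⟩ : ℤ × ℤ)).Rel (p, q) b := by
      constructor <;> simp only [b] <;> lia
    have hb' : b.1 + b.2 + 1 = p + q := by simp only [b]; lia
    have h1 := h b
    rw [F.page_d_mkE r (p, q) b hb x hx] at h1
    have h2 := (F.mkE_eq_zero _ (F.d_mem_Z hb.1.symm hx _)).1 h1
    have hb1 : (b.1 : ℤ) = p - r := by simp only [b]; lia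
    rw [hb1] at h2
    exact F.exists_sub_mem_Z hb' hx h2
  · refine ⟨0, zero_mem _, F.mem_Z.2 ⟨by simpa using hxF.1, fun m => ?_⟩⟩
    rw [sub_zero, F.eq_zero (by lia) (hxF.2 m)]
    exact zero_mem _

/-- Passing from the page `r` to the page `r + 1`. -/
def pageIso (r : ℤ) (hr : 2 ≤ r) (a : ℕ × ℕ) : (F.page r).homology a ≅ (F.page (r + 1)).X a := by
  refine homologyIsoQuotient (F.page r) a
    (Submodule.mkQ _ ∘ₗ Submodule.inclusion (F.Z_anti r a.1 (a.1 + a.2))) _ ?_ ?_ ?_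
  · rintro ⟨x, hx⟩ b
    by_cases h : (ComplexShape.spectralSequenceNat (⟨-r, r - 1⟩ : ℤ × ℤ)).Rel a b
    · refine (F.page_d_mkE r a b h x (F.Z_anti _ _ _ hx)).trans ((F.mkE_eq_zero _ _).2 ?_)
      refine F.mem_B.2 ⟨_, F.mono ?_ _ ((F.mem_Z.1 hx).2 _), 0, zero_mem _, by simp⟩
      have := h.1
      dsimp only at this
      lia
    · rw [(F.page r).shape _ _ h]
      rfl
  · intro e he
    obtain ⟨⟨x, hx⟩, rfl⟩ := Submodule.Quotient.mk_surjective _ e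
    obtain ⟨w, hw, hz⟩ := F.exists_mem_Z_succ r hr a x hx he
    refine ⟨⟨x - w, hz⟩, a, 0, ?_⟩
    rw [map_zero, add_zero]
    refine (Submodule.Quotient.eq _).2 (F.mem_B.2 ⟨w, hw, 0, zero_mem _, ?_⟩)
    rw [map_zero, add_zero]
    exact (sub_sub_cancel x w).symm
  · rintro ⟨z, hz⟩
    have hzF := F.mem_Z.1 hz
    change z ∈ F.B (r + 1) a.1 (a.1 + a.2) ↔
      ∃ b, ∃ y : (F.page r).X b, (F.page r).d b a y = F.mkE z (F.Z_anti _ _ _ hz)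
    constructor
    · intro h
      obtain ⟨w, hw, y, hy, rfl⟩ := F.mem_B.1 h
      by_cases hq : r ≤ a.2 + 1
      · let b : ℕ × ℕ := ((a.1 + r).toNat, (a.2 - r + 1).toNat)
        have hb : (ComplexShape.spectralSequenceNat (⟨-r, r - 1⟩ : ℤ × ℤ)).Rel b a := by
          constructor <;> simp only [b] <;> lia
        have hb' : b.1 + b.2 = a.1 + a.2 + 1 := by simp only [b]; lia
        have hb1 : (b.1 : ℤ) = a.1 + r := by simp only [b]; lia
        have key : ∃ y' : K.X (b.1 + b.2), y' ∈ F.Z r b.1 (b.1 + b.2) ∧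
            K.d _ (a.1 + a.2) y' = K.d _ (a.1 + a.2) y := by
          rw [hb']
          refine ⟨y, F.mem_Z.2 ⟨F.mono (by lia) _ hy, fun m => ?_⟩, rfl⟩
          by_cases hm : (ComplexShape.down ℕ).Rel (a.1 + a.2 + 1) m
          · obtain rfl : m = a.1 + a.2 := Nat.succ.inj hm
            rw [← add_sub_cancel_left w (K.d _ (a.1 + a.2) y)]
            exact sub_mem (F.mono (by lia) _ hzF.1) (F.mono (by lia) _ hw)
          · rw [K.shape _ _ hm]
            exact zero_mem _
        obtain ⟨y', hy', hyy'⟩ := key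
        refine ⟨b, F.mkE y' hy', (F.page_d_mkE r b a hb y' hy').trans ((Submodule.Quotient.eq _).2 ?_)⟩
        refine F.mem_B.2 ⟨-w, neg_mem hw, 0, zero_mem _, ?_⟩
        change _ = K.d _ _ y' - (w + K.d _ _ y)
        rw [hyy', map_zero]
        abel
      · -- no differential of the page `r` arrives here, and `F_{p+r-1}` is everything in degree `n + 1`
        refine ⟨a, 0, ?_⟩
        refine (map_zero _).trans ((F.mkE_eq_zero _ _).2 ?_).symm
        exact F.mem_B.2 ⟨w, hw, y, F.mem_of_le (by push_cast; lia) y, rfl⟩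
    · rintro ⟨b, y, hy⟩
      by_cases h : (ComplexShape.spectralSequenceNat (⟨-r, r - 1⟩ : ℤ × ℤ)).Rel b a
      · obtain ⟨⟨y, hyZ⟩, rfl⟩ := Submodule.Quotient.mk_surjective _ y
        have h2 := (F.page_d_mkE r b a h y hyZ).symm.trans hy
        have h1 := h.1
        have h1' := h.2
        dsimp only at h1 h1'
        obtain ⟨w, hw, y', hy', hwy⟩ := F.mem_B.1 ((F.mkE_eq_mkE _ _ _ _).1 h2)
        have key : ∃ y'' : K.X (a.1 + a.2 + 1), y'' ∈ F.F (a.1 + r) (a.1 + a.2 + 1) ∧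
            K.d _ (a.1 + a.2) y'' = K.d _ (a.1 + a.2) y := by
          have hb' : a.1 + a.2 + 1 = b.1 + b.2 := by lia
          rw [hb']
          exact ⟨y, F.mono (by lia) _ (F.mem_Z.1 hyZ).1, rfl⟩
        obtain ⟨y'', hy'', hyy⟩ := key
        refine F.mem_B.2 ⟨-w, neg_mem hw, y'' - y', ?_, ?_⟩
        · exact sub_mem (F.mono (by lia) _ hy'') (F.mono (by lia) _ hy')
        · rw [map_sub, hyy]
          change w + _ = K.d _ _ y - z at hwy
          rw [← sub_eq_zero] at hwy ⊢
          rw [← neg_eq_zero, ← hwy]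
          abel
      · rw [(F.page r).shape _ _ h] at hy
        have := (F.mkE_eq_zero _ _).1 hy.symm
        obtain ⟨w, hw, y', hy', rfl⟩ := F.mem_B.1 this
        exact F.mem_B.2 ⟨w, hw, y', F.mono (by lia) _ hy', rfl⟩

/-- The spectral sequence of a filtered complex. -/
def spectralSequence : FirstQuadrantSpectralSequence k where
  page r _ := F.page r
  iso r r' pq h hr := F.pageIso r hr pq ≪≫ eqToIso (by subst h; rfl)

end ChainFiltration

end FilteredComplex

/-! ### Homology classes of cycles -/

section HomologyClasses

variable {k : Type u} [CommRing k] {ι : Type*} {c : ComplexShape ι}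

/-- The submodule of cycles of a complex of modules. -/
def cycleSubmodule (K : HomologicalComplex (ModuleCat.{u} k) c) (i : ι) : Submodule k (K.X i) :=
  ⨅ j, LinearMap.ker (K.d i j).hom

lemma mem_cycleSubmodule {K : HomologicalComplex (ModuleCat.{u} k) c} {i : ι} {x : K.X i} :
    x ∈ cycleSubmodule K i ↔ ∀ j, K.d i j x = 0 := by
  simp only [cycleSubmodule, Submodule.mem_iInf, LinearMap.mem_ker]

/-- The homology class of a cycle. -/
def homologyClass (K : HomologicalComplex (ModuleCat.{u} k) c) (i : ι) :
    cycleSubmodule K i →ₗ[k] K.homology i :=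
  ((K.sc i).moduleCatCyclesIso.inv ≫ K.homologyπ i).hom ∘ₗ
    Submodule.inclusion (iInf_le (fun j => LinearMap.ker (K.d i j).hom) (c.next i))

lemma iCycles_inv_apply (K : HomologicalComplex (ModuleCat.{u} k) c) (i : ι)
    (x : LinearMap.ker (K.sc i).g.hom) :
    (K.sc i).iCycles ((K.sc i).moduleCatCyclesIso.inv x) = x.1 :=
  congrArg (fun f => f.hom x) (K.sc i).moduleCatCyclesIso_inv_iCycles

lemma homologyClass_surjective (K : HomologicalComplex (ModuleCat.{u} k) c) (i : ι) :
    Function.Surjective (homologyClass K i) := by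
  intro a
  obtain ⟨z, rfl⟩ := (ModuleCat.epi_iff_surjective (K.homologyπ i)).1 inferInstance a
  have hz : K.d i (c.next i) ((K.sc i).moduleCatCyclesIso.hom z).1 = 0 :=
    ((K.sc i).moduleCatCyclesIso.hom z).2
  refine ⟨⟨((K.sc i).moduleCatCyclesIso.hom z).1, mem_cycleSubmodule.2 fun j => ?_⟩, ?_⟩
  · by_cases h : c.Rel i j
    · obtain rfl := c.next_eq' h
      exact hz
    · rw [K.shape _ _ h]
      rfl
  · exact congrArg (K.homologyπ i) ((K.sc i).moduleCatCyclesIso.hom_inv_id_apply z)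

lemma homologyClass_eq_zero_iff {K : HomologicalComplex (ModuleCat.{u} k) c} {i : ι}
    (z : cycleSubmodule K i) : homologyClass K i z = 0 ↔ ∃ (j : ι) (y : K.X j), K.d j i y = z := by
  obtain ⟨x, hx⟩ := z
  let x' : LinearMap.ker (K.sc i).g.hom := ⟨x, mem_cycleSubmodule.1 hx _⟩
  have h1 : homologyClass K i ⟨x, hx⟩ =
      (K.sc i).moduleCatHomologyIso.inv (Submodule.Quotient.mk x') :=
    congrArg (fun f => f.hom x') (K.sc i).moduleCatCyclesIso_inv_π
  have h2 : homologyClass K i ⟨x, hx⟩ = 0 ↔ (Submodule.Quotient.mk x' :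
      LinearMap.ker (K.sc i).g.hom ⧸ LinearMap.range (K.sc i).moduleCatToCycles) = 0 := by
    rw [h1]
    exact map_eq_zero_iff _ ((ModuleCat.mono_iff_injective _).1 inferInstance)
  rw [h2, Submodule.Quotient.mk_eq_zero]
  constructor
  · rintro ⟨y, hy⟩
    exact ⟨_, y, congrArg Subtype.val hy⟩
  · rintro ⟨j, y, hy⟩
    by_cases h : c.Rel j i
    · obtain rfl := c.prev_eq' h
      exact ⟨y, Subtype.ext hy⟩
    · refine ⟨0, Subtype.ext ?_⟩
      rw [K.shape _ _ h] at hy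
      rw [map_zero]
      exact hy

lemma map_mem_cycleSubmodule {K L : HomologicalComplex (ModuleCat.{u} k) c} (φ : K ⟶ L) {i : ι}
    {x : K.X i} (hx : x ∈ cycleSubmodule K i) : φ.f i x ∈ cycleSubmodule L i := by
  refine mem_cycleSubmodule.2 fun j => ?_
  rw [← ConcreteCategory.comp_apply, φ.comm, ConcreteCategory.comp_apply, mem_cycleSubmodule.1 hx,
    map_zero]

lemma homologyMap_homologyClass {K L : HomologicalComplex (ModuleCat.{u} k) c} (φ : K ⟶ L) (i : ι)
    (z : cycleSubmodule K i) :
    HomologicalComplex.homologyMap φ i (homologyClass K i z) =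
      homologyClass L i ⟨φ.f i z, map_mem_cycleSubmodule φ z.2⟩ := by
  let z' : LinearMap.ker (K.sc i).g.hom := ⟨z.1, mem_cycleSubmodule.1 z.2 _⟩
  let w' : LinearMap.ker (L.sc i).g.hom :=
    ⟨φ.f i z, mem_cycleSubmodule.1 (map_mem_cycleSubmodule φ z.2) _⟩
  change HomologicalComplex.homologyMap φ i (K.homologyπ i ((K.sc i).moduleCatCyclesIso.inv z')) =
    L.homologyπ i ((L.sc i).moduleCatCyclesIso.inv w')
  have h1 := iCycles_inv_apply K i z'
  have h2 := iCycles_inv_apply L i w'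
  generalize (K.sc i).moduleCatCyclesIso.inv z' = a at *
  generalize (L.sc i).moduleCatCyclesIso.inv w' = b at *
  change K.cycles i at a
  change L.cycles i at b
  change K.iCycles i a = z.1 at h1
  change L.iCycles i b = φ.f i z.1 at h2
  have h3 : HomologicalComplex.cyclesMap φ i a = b := by
    apply (ModuleCat.mono_iff_injective (L.iCycles i)).1 inferInstance
    rw [← ConcreteCategory.comp_apply, HomologicalComplex.cyclesMap_i,
      ConcreteCategory.comp_apply, h1, h2]
  rw [← h3, ← ConcreteCategory.comp_apply, HomologicalComplex.homologyπ_naturality,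
    ConcreteCategory.comp_apply]

end HomologyClasses

/-! ### Convergence of the spectral sequence of a filtered complex -/

namespace ChainFiltration

variable {k : Type u} [CommRing k] {K : ChainComplex (ModuleCat.{u} k) ℕ} (F : ChainFiltration K)

/-- The filtration induced on homology: the classes of the cycles in `F_p`. -/
def homologyF (p : ℤ) (n : ℕ) : Submodule k (K.homology n) :=
  ((F.F p n).submoduleOf (cycleSubmodule K n)).map (homologyClass K n)

lemma homologyClass_mem_homologyF {p : ℤ} {n : ℕ} (z : cycleSubmodule K n)
    (hz : (z : K.X n) ∈ F.F p n) : homologyClass K n z ∈ F.homologyF p n :=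
  ⟨z, hz, rfl⟩

lemma mem_cycleSubmodule_of_mem_Z {r p : ℤ} {n : ℕ} (h : p < r) {x : K.X n}
    (hx : x ∈ F.Z r p n) : x ∈ cycleSubmodule K n :=
  mem_cycleSubmodule.2 fun m => F.eq_zero (by lia) ((F.mem_Z.1 hx).2 m)

/-- For `r` large, `E^r_p` is the graded piece of the filtration on homology. -/
lemma nonempty_gradedEquiv (r p : ℤ) (n : ℕ) (h : p < r) (hn : n + 2 ≤ p + r) :
    Nonempty ((F.homologyF p n ⧸ (F.homologyF (p - 1) n).submoduleOf (F.homologyF p n)) ≃ₗ[k]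
      F.E r p n) := by
  let f : F.Z r p n →ₗ[k] F.homologyF p n :=
    (homologyClass K n ∘ₗ Submodule.inclusion fun x hx => F.mem_cycleSubmodule_of_mem_Z h hx).codRestrict
      _ fun x => F.homologyClass_mem_homologyF _ (F.mem_Z.1 x.2).1
  let ψ : F.Z r p n →ₗ[k] F.homologyF p n ⧸ (F.homologyF (p - 1) n).submoduleOf (F.homologyF p n) :=
    Submodule.mkQ _ ∘ₗ f
  have hsur : Function.Surjective ψ := by
    refine (Submodule.Quotient.mk_surjective _).comp ?_
    rintro ⟨-, z, hz, rfl⟩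
    refine ⟨⟨z.1, F.mem_Z.2 ⟨hz, fun m => ?_⟩⟩, rfl⟩
    rw [mem_cycleSubmodule.1 z.2]
    exact zero_mem _
  have hker : LinearMap.ker ψ = (F.B r p n).submoduleOf (F.Z r p n) := by
    ext ⟨x, hx⟩
    have hxc := F.mem_cycleSubmodule_of_mem_Z h hx
    rw [LinearMap.mem_ker]
    refine (Submodule.Quotient.mk_eq_zero _).trans ?_
    change homologyClass K n ⟨x, hxc⟩ ∈ F.homologyF (p - 1) n ↔ x ∈ F.B r p n
    rw [mem_B]
    constructor
    · rintro ⟨w, hw, hwx⟩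
      rw [eq_comm, ← sub_eq_zero, ← map_sub, homologyClass_eq_zero_iff] at hwx
      obtain ⟨m, y, hy⟩ := hwx
      refine ⟨w, hw, ?_⟩
      change K.d m n y = x - w at hy
      by_cases hm : (ComplexShape.down ℕ).Rel m n
      · obtain rfl : n + 1 = m := hm
        exact ⟨y, F.mem_of_le (by push_cast; lia) y, by rw [hy]; abel⟩
      · rw [K.shape _ _ hm] at hy
        exact ⟨0, zero_mem _, by rw [map_zero, add_zero]; exact (sub_eq_zero.1 hy.symm).symm⟩
    · rintro ⟨w, hw, y, -, rfl⟩
      have hwc : w ∈ cycleSubmodule K n := mem_cycleSubmodule.2 fun m => by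
        have := mem_cycleSubmodule.1 hxc m
        rwa [map_add, d_d, add_zero] at this
      refine ⟨⟨w, hwc⟩, hw, ?_⟩
      rw [eq_comm, ← sub_eq_zero, ← map_sub, homologyClass_eq_zero_iff]
      exact ⟨_, y, (add_sub_cancel_left w _).symm⟩
  exact ⟨((Submodule.quotEquivOfEq _ _ hker.symm).trans (ψ.quotKerEquivOfSurjective hsur)).symm⟩

/-- The spectral sequence of a filtered complex converges to the homology of the complex. -/
theorem convergesTo : ConvergesTo F.spectralSequence fun n => K.homology n := by
  intro n
  refine ⟨fun p => F.homologyF p n, fun p p' h => ?_, ?_, ?_, ?_⟩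
  · exact Submodule.map_mono fun x hx => F.mono h n hx
  · refine (Submodule.eq_bot_iff _).2 ?_
    rintro - ⟨z, hz, rfl⟩
    rw [show z = 0 from Subtype.ext (F.eq_zero (by decide) hz), map_zero]
  · refine Submodule.eq_top_iff'.2 fun a => ?_
    obtain ⟨z, rfl⟩ := homologyClass_surjective K n a
    exact F.homologyClass_mem_homologyF z (F.mem_of_le le_rfl _)
  · rintro p q rfl
    exact F.nonempty_gradedEquiv _ p (p + q) (by lia) (by push_cast; lia)

end ChainFiltration

/-- Convergence depends on the limit only up to isomorphism. -/
lemma ConvergesTo.of_iso {k : Type u} [CommRing k] {E : FirstQuadrantSpectralSequence k}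
    {H H' : ℕ → ModuleCat.{u} k} (h : ConvergesTo E H) (e : ∀ n, H n ≅ H' n) :
    ConvergesTo E H' := by
  intro n
  obtain ⟨F, hF, hbot, htop, hgr⟩ := h n
  let φ := (e n).toLinearEquiv
  refine ⟨fun p => (F p).map φ.toLinearMap, fun p p' hp => Submodule.map_mono (hF hp), ?_, ?_, ?_⟩
  · simp only [hbot, Submodule.map_bot]
  · simp only [htop, Submodule.map_top]
    exact LinearEquiv.range φ
  · intro p q hpq
    obtain ⟨ψ⟩ := hgr p q hpq
    refine ⟨(Submodule.Quotient.equiv _ _ (φ.submoduleMap (F p)) ?_).symm.trans ψ⟩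
    ext ⟨x, hx⟩
    constructor
    · rintro ⟨y, hy, hyx⟩
      exact ⟨y.1, hy, congrArg Subtype.val hyx⟩
    · rintro ⟨y, hy, hyx⟩
      exact ⟨⟨y, hF (by lia) hy⟩, hy, Subtype.ext hyx⟩

/-! ### First quadrant double complexes -/

/-- A first quadrant double complex of modules, with commuting horizontal differentials
`X_{p+1,q} → X_{p,q}` and vertical differentials `X_{p,q+1} → X_{p,q}`. -/
structure DoubleComplex (k : Type u) [CommRing k] where
  X : ℕ → ℕ → Type u
  [addCommGroup : ∀ p q, AddCommGroup (X p q)]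
  [module : ∀ p q, Module k (X p q)]
  dh (p q : ℕ) : X (p + 1) q →ₗ[k] X p q
  dv (p q : ℕ) : X p (q + 1) →ₗ[k] X p q
  dh_dh (p q : ℕ) (x : X (p + 2) q) : dh p q (dh (p + 1) q x) = 0
  dv_dv (p q : ℕ) (x : X p (q + 2)) : dv p q (dv p (q + 1) x) = 0
  dh_dv (p q : ℕ) (x : X (p + 1) (q + 1)) : dh p q (dv (p + 1) q x) = dv p q (dh p (q + 1) x)

attribute [instance] DoubleComplex.addCommGroup DoubleComplex.module

namespace DoubleComplex

variable {k : Type u} [CommRing k] (D : DoubleComplex k)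

/-- The module of total degree `n`: the product of the modules `X_{p,q}` with `p + q = n`. -/
abbrev Tot (n : ℕ) : Type u := ∀ i : {i : ℕ × ℕ // i.1 + i.2 = n}, D.X i.1.1 i.1.2

/-- The total differential, with components `dh + (-1)^p dv`. -/
def totD (n : ℕ) : D.Tot (n + 1) →ₗ[k] D.Tot n :=
  LinearMap.pi fun i =>
    D.dh i.1.1 i.1.2 ∘ₗ LinearMap.proj (⟨(i.1.1 + 1, i.1.2), by have := i.2; dsimp; lia⟩ :
      {j : ℕ × ℕ // j.1 + j.2 = n + 1}) +
    (-1 : k) ^ i.1.1 • D.dv i.1.1 i.1.2 ∘ₗ LinearMap.proj (⟨(i.1.1, i.1.2 + 1), by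
      have := i.2; dsimp; lia⟩ : {j : ℕ × ℕ // j.1 + j.2 = n + 1})

lemma totD_apply (n : ℕ) (x : D.Tot (n + 1)) (p q : ℕ) (h : p + q = n) :
    D.totD n x ⟨(p, q), h⟩ = D.dh p q (x ⟨(p + 1, q), by dsimp; lia⟩) +
      (-1 : k) ^ p • D.dv p q (x ⟨(p, q + 1), by dsimp; lia⟩) :=
  rfl

/-- The total complex. -/
def total : ChainComplex (ModuleCat.{u} k) ℕ :=
  ChainComplex.of (fun n => ModuleCat.of k (D.Tot n)) (fun n => ModuleCat.ofHom (D.totD n)) fun n => by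
    refine ModuleCat.hom_ext (LinearMap.ext fun x => funext ?_)
    rintro ⟨⟨p, q⟩, h⟩
    change D.totD n (D.totD (n + 1) x) ⟨(p, q), h⟩ = 0
    rw [totD_apply, totD_apply, totD_apply, map_add, map_add, dh_dh, map_smul, map_smul, dv_dv,
      dh_dv, pow_succ]
    simp

/-- The component of bidegree `(p, q)`. -/
def comp {n : ℕ} (p q : ℕ) (h : p + q = n) : D.total.X n →ₗ[k] D.X p q :=
  LinearMap.proj (φ := fun i : {i : ℕ × ℕ // i.1 + i.2 = n} => D.X i.1.1 i.1.2) ⟨(p, q), h⟩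

/-- The inclusion of the summand of bidegree `(p, q)`. -/
def inc {n : ℕ} (p q : ℕ) (h : p + q = n) : D.X p q →ₗ[k] D.total.X n :=
  LinearMap.single k (fun i : {i : ℕ × ℕ // i.1 + i.2 = n} => D.X i.1.1 i.1.2) ⟨(p, q), h⟩

variable {D}

lemma comp_ext {n : ℕ} {x y : D.total.X n} (h : ∀ p q h, D.comp p q h x = D.comp p q h y) :
    x = y :=
  funext fun i => h i.1.1 i.1.2 i.2

lemma comp_inc_self {n : ℕ} (p q : ℕ) (h h' : p + q = n) (v : D.X p q) :
    D.comp p q h (D.inc p q h' v) = v :=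
  Pi.single_eq_same (M := fun i : {i : ℕ × ℕ // i.1 + i.2 = n} => D.X i.1.1 i.1.2) ⟨(p, q), h⟩ v

lemma comp_inc_of_ne {n : ℕ} {p q a b : ℕ} (h : p + q = n) (h' : a + b = n) (hne : a ≠ p)
    (v : D.X p q) : D.comp a b h' (D.inc p q h v) = 0 :=
  Pi.single_eq_of_ne (M := fun i : {i : ℕ × ℕ // i.1 + i.2 = n} => D.X i.1.1 i.1.2)
    (i := ⟨(p, q), h⟩) (i' := ⟨(a, b), h'⟩) (fun e => hne (congrArg (fun i => i.1.1) e)) v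

lemma comp_d {n : ℕ} (p q : ℕ) (h : p + q = n) (x : D.total.X (n + 1)) :
    D.comp p q h (D.total.d (n + 1) n x) = D.dh p q (D.comp (p + 1) q (by lia) x) +
      (-1 : k) ^ p • D.dv p q (D.comp p (q + 1) (by lia) x) := by
  have : D.total.d (n + 1) n = ModuleCat.ofHom (D.totD n) :=
    ChainComplex.of_d (fun n => ModuleCat.of k (D.Tot n)) (fun n => ModuleCat.ofHom (D.totD n)) n
  rw [this]
  rfl

lemma neg_one_pow_smul_smul {V : Type*} [AddCommGroup V] [Module k V] (p : ℕ) (v : V) :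
    (-1 : k) ^ p • (-1 : k) ^ p • v = v := by
  rw [smul_smul, ← mul_pow]
  simp

variable (D)

/-- The filtration of the total complex by the first degree. -/
def filtration : ChainFiltration D.total where
  F p n := ⨅ (a : ℕ) (b : ℕ) (h : a + b = n) (_ : p < a), LinearMap.ker (D.comp a b h)
  mono {p p'} hp n x hx := by
    simp only [Submodule.mem_iInf, LinearMap.mem_ker] at hx ⊢
    exact fun a b h ha => hx a b h (by lia)
  d_mem {p n x} hx m := by
    by_cases hm : (ComplexShape.down ℕ).Rel n m
    · obtain rfl : m + 1 = n := hm
      simp only [Submodule.mem_iInf, LinearMap.mem_ker] at hx ⊢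
      intro a b h ha
      rw [comp_d, hx _ _ _ (by push_cast; lia), hx _ _ _ ha, map_zero, map_zero, smul_zero, add_zero]
    · rw [D.total.shape _ _ hm]
      exact zero_mem _
  eq_zero {p} hp n x hx := by
    simp only [Submodule.mem_iInf, LinearMap.mem_ker] at hx
    exact comp_ext fun a b h => (hx a b h (by lia)).trans (map_zero _).symm
  mem_of_le {p n} hp x := by
    simp only [Submodule.mem_iInf, LinearMap.mem_ker]
    intro a b h ha
    lia

variable {D}

lemma mem_filtration {p : ℤ} {n : ℕ} {x : D.total.X n} :
    x ∈ D.filtration.F p n ↔ ∀ (a b : ℕ) (h : a + b = n), p < a → D.comp a b h x = 0 := by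
  simp only [filtration, Submodule.mem_iInf, LinearMap.mem_ker]

variable (D)

/-- The vertical cycles. -/
def vCycles (p : ℕ) : ∀ q : ℕ, Submodule k (D.X p q)
  | 0 => ⊤
  | q + 1 => LinearMap.ker (D.dv p q)

variable {D}

lemma dh_mem_vCycles {p q : ℕ} {x : D.X (p + 1) q} (hx : x ∈ D.vCycles (p + 1) q) :
    D.dh p q x ∈ D.vCycles p q := by
  cases q with
  | zero => trivial
  | succ q => exact (D.dh_dv p q x).symm.trans ((congrArg _ hx).trans (map_zero _))

lemma comp_mem_vCycles {p q n : ℕ} (h : p + q = n) {x : D.total.X n}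
    (hx : x ∈ D.filtration.F p n) (hdx : ∀ m, D.total.d n m x ∈ D.filtration.F (p - 1) m) :
    D.comp p q h x ∈ D.vCycles p q := by
  cases q with
  | zero => trivial
  | succ q =>
    obtain rfl : p + q + 1 = n := h
    have := mem_filtration.1 (hdx (p + q)) p q rfl (by lia)
    rw [comp_d, mem_filtration.1 hx _ _ _ (by push_cast; lia), map_zero, zero_add] at this
    have h2 := congrArg ((-1 : k) ^ p • ·) this
    rw [neg_one_pow_smul_smul, smul_zero] at h2
    exact h2

lemma comp_d_inc_vCycles {p q n a b : ℕ} (h : p + q = n + 1) {v : D.X p q} (hv : v ∈ D.vCycles p q)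
    (hab : a + b = n) (ha : a + 1 ≠ p) : D.comp a b hab (D.total.d (n + 1) n (D.inc p q h v)) = 0 := by
  rw [comp_d, comp_inc_of_ne _ _ ha, map_zero, zero_add]
  by_cases hap : a = p
  · subst hap
    obtain rfl : b + 1 = q := by lia
    rw [comp_inc_self, show D.dv a b v = 0 from hv, smul_zero]
  · rw [comp_inc_of_ne _ _ hap, map_zero, smul_zero]

/-! ### The second page for the filtration by the first degree -/

section SecondPage

variable {q : ℕ} (R : ChainComplex (ModuleCat.{u} k) ℕ)
  (θ : ∀ p, D.vCycles p q →ₗ[k] R.X p)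

/-- Correcting a vertical cycle whose image in `R` is a cycle to an element of `F_p` with boundary in
`F_{p-2}`. -/
lemma exists_mem_Z_two (hθ0 : ∀ p x, θ p x = 0 ↔ ∃ y, D.dv p q y = x)
    (hθd : ∀ p x, R.d (p + 1) p (θ (p + 1) x) = θ p ⟨D.dh p q x, dh_mem_vCycles x.2⟩)
    (p : ℕ) (v : D.vCycles p q) (hv : ∀ j, R.d p j (θ p v) = 0) (n : ℕ) (hn : p + q = n) :
    ∃ z ∈ D.filtration.Z 2 p n, D.comp p q hn z = v := by
  cases p with
  | zero =>
    refine ⟨D.inc 0 q hn v, D.filtration.mem_Z.2 ⟨mem_filtration.2 fun a b h ha => ?_, fun m => ?_⟩,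
      comp_inc_self _ _ _ _ _⟩
    · exact comp_inc_of_ne _ _ (by lia) _
    · by_cases hm : (ComplexShape.down ℕ).Rel n m
      · obtain rfl : m + 1 = n := hm
        exact mem_filtration.2 fun a b h _ => comp_d_inc_vCycles hn v.2 h (by lia)
      · rw [D.total.shape _ _ hm]
        exact zero_mem _
  | succ p =>
    obtain ⟨y, hy⟩ := (hθ0 p _).1 ((hθd p v).symm.trans (hv p))
    obtain ⟨n, rfl⟩ : ∃ n', n = n' + 1 := ⟨p + q, by lia⟩
    have hn' : p + (q + 1) = n + 1 := by lia
    let y' : D.X p (q + 1) := (-1 : k) ^ p • y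
    let z : D.total.X (n + 1) := D.inc (p + 1) q hn v - D.inc p (q + 1) hn' y'
    have h1 (h) : D.comp (p + 1) q h z = v := by
      rw [map_sub, comp_inc_self, comp_inc_of_ne _ _ (by lia), sub_zero]
    have h2 (h) : D.comp p (q + 1) h z = -y' := by
      rw [map_sub, comp_inc_self, comp_inc_of_ne _ _ (by lia), zero_sub]
    refine ⟨z, D.filtration.mem_Z.2 ⟨mem_filtration.2 fun a b h ha => ?_, fun m => ?_⟩, h1 hn⟩
    · rw [map_sub, comp_inc_of_ne _ _ (by lia), comp_inc_of_ne _ _ (by lia), sub_zero]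
    · by_cases hm : (ComplexShape.down ℕ).Rel (n + 1) m
      · obtain rfl : m = n := Nat.succ.inj hm
        refine mem_filtration.2 fun a b h ha => ?_
        by_cases hap : a = p
        · subst hap
          obtain rfl : b = q := by lia
          rw [comp_d, h1, h2, map_neg, smul_neg, map_smul, neg_one_pow_smul_smul, hy]
          exact add_neg_cancel _
        · rw [map_sub, map_sub, comp_d_inc_vCycles hn v.2 h (by lia), comp_d,
            comp_inc_of_ne _ _ (by push_cast at ha; lia), comp_inc_of_ne _ _ hap]
          simp
      · rw [D.total.shape _ _ hm]
        exact zero_mem _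

/-- If the complex `R` is the `q`-th vertical homology, through the maps `θ` which send vertical cycles
to their classes, then its homology is the term `E^2_{p,q}` of the spectral sequence. -/
def secondPageIso (hsurj : ∀ p, Function.Surjective (θ p))
    (hθ0 : ∀ p x, θ p x = 0 ↔ ∃ y, D.dv p q y = x)
    (hθd : ∀ p x, R.d (p + 1) p (θ (p + 1) x) = θ p ⟨D.dh p q x, dh_mem_vCycles x.2⟩) (p : ℕ) :
    R.homology p ≅ pageTerm D.filtration.spectralSequence 2 le_rfl p q := by
  have hZ : ∀ x ∈ D.filtration.Z 2 p (p + q), D.comp p q rfl x ∈ D.vCycles p q := fun x hx =>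
    comp_mem_vCycles rfl (D.filtration.mem_Z.1 hx).1 fun m =>
      D.filtration.mono (by lia) m ((D.filtration.mem_Z.1 hx).2 m)
  refine homologyIsoQuotient R p (θ p ∘ₗ (D.comp p q rfl).restrict hZ) _ ?_ ?_ ?_
  · rintro ⟨x, hx⟩ j
    change R.d p j (θ p ⟨D.comp p q rfl x, _⟩) = 0
    by_cases hj : (ComplexShape.down ℕ).Rel p j
    · obtain rfl : j + 1 = p := hj
      refine (hθd j _).trans ((hθ0 j _).2 ?_)
      have key : ∀ N (h : j + 1 + q = N) (x : D.total.X N), x ∈ D.filtration.Z 2 (j + 1 : ℕ) N →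
          ∃ y, D.dv j q y = D.dh j q (D.comp (j + 1) q h x) := by
        intro N h x hx
        obtain ⟨n, rfl⟩ : ∃ n, N = n + 1 := ⟨j + q, by lia⟩
        have := mem_filtration.1 ((D.filtration.mem_Z.1 hx).2 n) j q (by lia) (by lia)
        rw [comp_d] at this
        refine ⟨-((-1 : k) ^ j • D.comp j (q + 1) (by lia) x), ?_⟩
        rw [map_neg, map_smul]
        exact (eq_neg_of_add_eq_zero_left this).symm
      exact key _ rfl x hx
    · rw [R.shape _ _ hj]
      rfl
  · intro r hr
    obtain ⟨v, rfl⟩ := hsurj p r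
    obtain ⟨z, hz, hzv⟩ := exists_mem_Z_two R θ hθ0 hθd p v hr _ rfl
    refine ⟨⟨z, hz⟩, p, 0, ?_⟩
    rw [map_zero, add_zero]
    exact congrArg (θ p) (Subtype.ext hzv.symm)
  · rintro ⟨z, hz⟩
    have hzF := (D.filtration.mem_Z.1 hz).1
    change z ∈ D.filtration.B 2 p (p + q) ↔
      ∃ j, ∃ y : R.X j, R.d j p y = θ p ⟨D.comp p q rfl z, hZ z hz⟩
    constructor
    · intro h
      obtain ⟨w, hw, y, hy, rfl⟩ := D.filtration.mem_B.1 h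
      have hyv : D.comp (p + 1) q (by lia) y ∈ D.vCycles (p + 1) q := by
        refine comp_mem_vCycles _ (D.filtration.mono (by push_cast; lia) _ hy) fun m => ?_
        by_cases hm : (ComplexShape.down ℕ).Rel (p + q + 1) m
        · obtain rfl : m = p + q := Nat.succ.inj hm
          rw [← add_sub_cancel_left w (D.total.d _ (p + q) y)]
          exact sub_mem (D.filtration.mono (by push_cast; lia) _ hzF)
            (D.filtration.mono (by push_cast; lia) _ hw)
        · rw [D.total.shape _ _ hm]
          exact zero_mem _
      refine ⟨p + 1, θ (p + 1) ⟨_, hyv⟩, ?_⟩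
      rw [hθd, eq_comm, ← sub_eq_zero, ← map_sub, hθ0]
      refine ⟨(-1 : k) ^ p • D.comp p (q + 1) (by lia) y, ?_⟩
      change _ = D.comp p q rfl (w + D.total.d (p + q + 1) (p + q) y) - D.dh p q _
      rw [map_add, comp_d, mem_filtration.1 hw p q rfl (by lia), map_smul]
      abel
    · rintro ⟨j, y, hy⟩
      obtain ⟨y', hy'⟩ : ∃ y' : R.X (p + 1), R.d (p + 1) p y' = θ p ⟨D.comp p q rfl z, hZ z hz⟩ := by
        by_cases hj : (ComplexShape.down ℕ).Rel j p
        · obtain rfl : p + 1 = j := hj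
          exact ⟨y, hy⟩
        · rw [R.shape _ _ hj] at hy
          exact ⟨0, (map_zero _).trans hy⟩
      obtain ⟨v, rfl⟩ := hsurj _ y'
      rw [hθd, eq_comm, ← sub_eq_zero, ← map_sub, hθ0] at hy'
      obtain ⟨t, ht⟩ := hy'
      change D.dv p q t = D.comp p q rfl z - D.dh p q v at ht
      let Y : D.total.X (p + q + 1) := D.inc (p + 1) q (by lia) v +
        D.inc p (q + 1) (by lia) ((-1 : k) ^ p • t)
      have h1 (h) : D.comp (p + 1) q h Y = v := by
        rw [map_add, comp_inc_self, comp_inc_of_ne _ _ (by lia), add_zero]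
      have h2 (h) : D.comp p (q + 1) h Y = (-1 : k) ^ p • t := by
        rw [map_add, comp_inc_self, comp_inc_of_ne _ _ (by lia), zero_add]
      refine D.filtration.mem_B.2 ⟨z - D.total.d _ _ Y, ?_, Y, ?_, sub_add_cancel _ _⟩
      · refine mem_filtration.2 fun a b h ha => ?_
        by_cases hap : a = p
        · subst hap
          obtain rfl : b = q := by lia
          rw [map_sub, comp_d, h1, h2, map_smul, neg_one_pow_smul_smul, ht]
          abel
        · rw [map_sub, mem_filtration.1 hzF _ _ _ (by lia), map_add, map_add,
            comp_d_inc_vCycles _ v.2 h (by lia), comp_d, comp_inc_of_ne _ _ (by lia),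
            comp_inc_of_ne _ _ (by lia)]
          simp
      · refine mem_filtration.2 fun a b h ha => ?_
        rw [map_add, comp_inc_of_ne _ _ (by lia), comp_inc_of_ne _ _ (by lia), add_zero]

end SecondPage

/-! ### Double complexes with exact rows -/

section Augmentation

variable (Y : ChainComplex (ModuleCat.{u} k) ℕ) (ε : ∀ q, D.X 0 q →ₗ[k] Y.X q)

/-- If the rows of a double complex are exact, apart from `ε`, then a total cycle whose components of
first degree less than `P` vanish, and whose component of first degree zero is killed by `ε`, bounds a chain without
component of first degree zero: the components are removed one at a time, in increasing first degree. -/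
lemma exists_d_eq (hε0 : ∀ q x, ε q x = 0 → ∃ y, D.dh 0 q y = x)
    (hdh : ∀ p q x, D.dh p q x = 0 → ∃ y, D.dh (p + 1) q y = x) (n : ℕ) :
    ∀ (N P : ℕ) (_ : n + 1 ≤ P + N) (x : D.total.X n) (_ : x ∈ cycleSubmodule D.total n)
      (_ : ∀ a b h, a < P → D.comp a b h x = 0)
      (_ : ∀ q h, ε q (D.comp 0 q h x) = 0),
      ∃ w : D.total.X (n + 1), D.total.d (n + 1) n w = x ∧ ∀ q h, D.comp 0 q h w = 0 := by
  intro N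
  induction N with
  | zero =>
    intro P hP x _ hx _
    exact ⟨0, (map_zero _).trans (comp_ext fun a b h => (map_zero _).trans (hx a b h (by lia)).symm),
      fun _ _ => map_zero _⟩
  | succ N ih =>
    intro P hP x hc hx hε
    by_cases hPn : n < P
    · exact ih P (by lia) x hc hx hε
    obtain ⟨q, hq⟩ := Nat.exists_eq_add_of_le (not_lt.1 hPn)
    obtain ⟨y, hy⟩ : ∃ y, D.dh P q y = D.comp P q hq.symm x := by
      cases P with
      | zero => exact hε0 q _ (hε q _)
      | succ P =>
        obtain rfl : n = P + q + 1 := by lia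
        apply hdh
        have h1 := congrArg (D.comp P q rfl) (mem_cycleSubmodule.1 hc (P + q))
        rw [comp_d, hx P _ _ (Nat.lt_succ_self P), map_zero, smul_zero, add_zero, map_zero] at h1
        exact h1
    let w : D.total.X (n + 1) := D.inc (P + 1) q (by lia) y
    have hw0 : ∀ q h, D.comp 0 q h w = 0 := fun q' h => comp_inc_of_ne _ _ (by lia) _
    have hx' : ∀ a b h, a < P + 1 → D.comp a b h (x - D.total.d (n + 1) n w) = 0 := by
      intro a b h ha
      rw [map_sub, comp_d, comp_inc_of_ne _ _ (show a ≠ P + 1 by lia), map_zero, smul_zero, add_zero]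
      by_cases haP : a = P
      · subst haP
        obtain rfl : b = q := by lia
        rw [comp_inc_self, hy, sub_self]
      · rw [hx a b h (by lia), comp_inc_of_ne _ _ (by lia), map_zero, sub_zero]
    -- `x - d w` is a cycle whose first `P + 1` components vanish
    obtain ⟨w', hw', hw'0⟩ := ih (P + 1) (by lia) (x - D.total.d (n + 1) n w)
      (sub_mem hc (mem_cycleSubmodule.2 fun m => ChainFiltration.d_d _ _ _ _)) hx'
      fun q' h => (congrArg _ (hx' 0 q' h (by lia))).trans (map_zero _)
    exact ⟨w' + w, by rw [map_add, hw', sub_add_cancel], fun q' h => by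
      rw [map_add, hw'0, hw0, add_zero]⟩

/-- If `⋯ → X_{1,q} → X_{0,q} → Y_q → 0` is exact for all `q`, then the total complex and `Y` have
isomorphic homology. -/
def homologyIsoOfAugmentation (hsurj : ∀ q, Function.Surjective (ε q))
    (hεdh : ∀ q x, ε q (D.dh 0 q x) = 0)
    (hεdv : ∀ q x, ε q (D.dv 0 q x) = Y.d (q + 1) q (ε (q + 1) x))
    (hε0 : ∀ q x, ε q x = 0 → ∃ y, D.dh 0 q y = x)
    (hdh : ∀ p q x, D.dh p q x = 0 → ∃ y, D.dh (p + 1) q y = x) (n : ℕ) :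
    D.total.homology n ≅ Y.homology n := by
  let N : Submodule k (cycleSubmodule D.total n) :=
    (LinearMap.range (D.total.d (n + 1) n).hom).submoduleOf _
  have hN (z : cycleSubmodule D.total n) :
      z ∈ N ↔ ∃ y : D.total.X (n + 1), D.total.d (n + 1) n y = z := Iff.rfl
  have hεd (m : ℕ) (x : D.total.X (m + 1)) : ε m (D.comp 0 m (zero_add m) (D.total.d (m + 1) m x)) =
      Y.d (m + 1) m (ε (m + 1) (D.comp 0 (m + 1) (zero_add _) x)) := by
    rw [comp_d, map_add, hεdh, zero_add, pow_zero, one_smul, hεdv]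
  refine homologyIsoQuotient D.total n (cycleSubmodule D.total n).subtype N
    (fun z j => mem_cycleSubmodule.1 z.2 j)
    (fun x hx => ⟨⟨x, mem_cycleSubmodule.2 hx⟩, n, 0, by rw [map_zero, add_zero]; rfl⟩) ?_ ≪≫
    (homologyIsoQuotient Y n (ε n ∘ₗ D.comp 0 n (zero_add n) ∘ₗ (cycleSubmodule D.total n).subtype)
      N ?_ ?_ ?_).symm
  · intro z
    rw [hN]
    constructor
    · rintro ⟨y, hy⟩
      exact ⟨_, y, hy⟩
    · rintro ⟨j, y, hy⟩
      by_cases hj : (ComplexShape.down ℕ).Rel j n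
      · obtain rfl : n + 1 = j := hj
        exact ⟨y, hy⟩
      · rw [D.total.shape _ _ hj] at hy
        exact ⟨0, (map_zero _).trans hy⟩
  · rintro ⟨z, hz⟩ j
    by_cases hj : (ComplexShape.down ℕ).Rel n j
    · obtain rfl : j + 1 = n := hj
      refine (hεd j z).symm.trans ?_
      rw [mem_cycleSubmodule.1 hz, map_zero, map_zero]
    · rw [Y.shape _ _ hj]
      rfl
  · intro y hy
    obtain ⟨x, rfl⟩ := hsurj n y
    cases n with
    | zero =>
      refine ⟨⟨D.inc 0 0 rfl x, mem_cycleSubmodule.2 fun j => ?_⟩, 0, 0, ?_⟩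
      · rw [D.total.shape _ _ (by simp)]
        rfl
      · rw [map_zero, add_zero]
        exact congrArg (ε 0) (comp_inc_self 0 0 rfl rfl x).symm
    | succ m =>
      let ξ : D.total.X (m + 1) := D.inc 0 (m + 1) (zero_add _) x
      have hξ : D.comp 0 (m + 1) (zero_add _) ξ = x := comp_inc_self _ _ _ _ x
      obtain ⟨w, hw, hw0⟩ := exists_d_eq Y ε hε0 hdh m (m + 1) 0 (by lia) (D.total.d (m + 1) m ξ)
        (mem_cycleSubmodule.2 fun j => ChainFiltration.d_d _ _ _ _) (fun a b h ha => by lia)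
        (fun q h => by
          obtain rfl : q = m := by lia
          rw [hεd, hξ]
          exact hy q)
      refine ⟨⟨ξ - w, mem_cycleSubmodule.2 fun j => ?_⟩, m, 0, ?_⟩
      · by_cases hj : (ComplexShape.down ℕ).Rel (m + 1) j
        · obtain rfl : j = m := Nat.succ.inj hj
          rw [map_sub, hw, sub_self]
        · rw [D.total.shape _ _ hj]
          rfl
      · rw [map_zero, add_zero]
        change _ = ε (m + 1) (D.comp 0 (m + 1) _ (ξ - w))
        rw [map_sub, hξ, hw0, sub_zero]
  · rintro ⟨z, hz⟩
    rw [hN]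
    constructor
    · rintro ⟨y, rfl⟩
      exact ⟨n + 1, ε (n + 1) (D.comp 0 (n + 1) (zero_add _) y), (hεd n y).symm⟩
    · rintro ⟨j, y, hy⟩
      change Y.d j n y = ε n (D.comp 0 n _ z) at hy
      obtain ⟨y', hy'⟩ : ∃ y' : Y.X (n + 1), Y.d (n + 1) n y' = ε n (D.comp 0 n (zero_add n) z) := by
        by_cases hj : (ComplexShape.down ℕ).Rel j n
        · obtain rfl : n + 1 = j := hj
          exact ⟨y, hy⟩
        · rw [Y.shape _ _ hj] at hy
          exact ⟨0, (map_zero _).trans hy⟩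
      obtain ⟨x, rfl⟩ := hsurj _ y'
      let ξ : D.total.X (n + 1) := D.inc 0 (n + 1) (zero_add _) x
      obtain ⟨w, hw, -⟩ := exists_d_eq Y ε hε0 hdh n (n + 1) 0 (by lia) (z - D.total.d (n + 1) n ξ)
        (sub_mem hz (mem_cycleSubmodule.2 fun j => ChainFiltration.d_d _ _ _ _))
        (fun a b h ha => by lia) (fun q h => by
          obtain rfl : q = n := by lia
          rw [map_sub, map_sub, hεd, comp_inc_self, hy', sub_self])
      exact ⟨w + ξ, by rw [map_add, hw, sub_add_cancel]⟩

end Augmentation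

end DoubleComplex

/-! ### Contracting the inhomogeneous chains of an induced representation -/

section BarContraction

variable {k G : Type u} [CommRing k] [Group G]

lemma contractNth_zero_cons {p : ℕ} (γ : G) (g : Fin (p + 1) → G) :
    Fin.contractNth 0 (· * ·) (Fin.cons γ g : Fin (p + 2) → G) =
      Fin.cons (γ * g 0) fun i => g i.succ := by
  funext i
  refine Fin.cases ?_ (fun i => ?_) i
  · simp [Fin.contractNth]
  · simp [Fin.contractNth]

lemma contractNth_succ_cons {p : ℕ} (γ : G) (g : Fin (p + 1) → G) (j : Fin (p + 1)) :
    Fin.contractNth j.succ (· * ·) (Fin.cons γ g : Fin (p + 2) → G) =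
      Fin.cons γ (Fin.contractNth j (· * ·) g) := by
  funext i
  refine Fin.cases ?_ (fun i => ?_) i
  · simp [Fin.contractNth]
  · simp [Fin.contractNth]

variable (A : Rep.{u} k G)

/-- A `G`-grading of a representation which `s ∈ G` shifts by right multiplication with `s⁻¹`. It is
encoded by the map `c` which sends an element `a` of degree `γ` to `γ a`, placed in degree `γ`. A
representation admits such a grading if and only if it is induced from the trivial subgroup. -/
structure FreeGrading where
  c : A →ₗ[k] (G →₀ A)
  c_ρ (s : G) (a : A) : c (A.ρ s a) = Finsupp.lmapDomain A k (fun γ => γ * s⁻¹) (c a)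
  sum_c (a : A) : Finsupp.lsum k (fun γ => A.ρ γ⁻¹) (c a) = a

namespace FreeGrading

variable {A} (Γ : FreeGrading A)

/-- The sum of the elements `γ a` for the homogeneous components `a` of an element, with `γ` the
degree of `a`. -/
def retract : A →ₗ[k] A := Finsupp.lsum k (fun _ => LinearMap.id) ∘ₗ Γ.c

/-- The contraction of the complex of inhomogeneous chains, which sends `(g_1, …, g_p) ⊗ a` to
`(γ, g_1, …, g_p) ⊗ γ a` for `a` of degree `γ`. -/
def contraction (p : ℕ) : ((Fin p → G) →₀ A) →ₗ[k] ((Fin (p + 1) → G) →₀ A) :=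
  Finsupp.lsum k fun g => Finsupp.lmapDomain A k (fun γ => (Fin.cons γ g : Fin (p + 1) → G)) ∘ₗ Γ.c

lemma contraction_single (p : ℕ) (g : Fin p → G) (a : A) :
    Γ.contraction p (Finsupp.single g a) =
      Finsupp.lmapDomain A k (fun γ => (Fin.cons γ g : Fin (p + 1) → G)) (Γ.c a) :=
  Finsupp.lsum_single ..

/-- The boundary of `(γ, g_1, …, g_p) ⊗ b`, extended linearly in the pair `(γ, b)`: the faces other than
the first one are moved to the left, where they form a chain of the shape of a contraction. -/
lemma d_cons {p : ℕ} (g : Fin (p + 1) → G) (u : G →₀ A) :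
    (groupHomology.inhomogeneousChains.d A (p + 1)).hom
        (Finsupp.lmapDomain A k (fun γ => (Fin.cons γ g : Fin (p + 2) → G)) u) +
      (Finsupp.lmapDomain A k (fun γ => (Fin.cons γ fun i => g i.succ : Fin (p + 1) → G))
        (Finsupp.lmapDomain A k (fun γ => γ * g 0) u) +
      ∑ j : Fin (p + 1), (-1 : k) ^ ((j : ℕ) + 1) •
        Finsupp.lmapDomain A k
          (fun γ => (Fin.cons γ (Fin.contractNth j (· * ·) g) : Fin (p + 1) → G)) u) =
      Finsupp.single g (Finsupp.lsum k (fun γ => A.ρ γ⁻¹) u) := by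
  induction u using Finsupp.induction_linear with
  | zero => simp
  | add u v hu hv =>
    simp only [map_add, smul_add, Finset.sum_add_distrib, Finsupp.single_add, ← hu, ← hv]
    abel
  | single γ b =>
    have h := groupHomology.inhomogeneousChains.d_single (A := A) (p + 1)
      (Fin.cons γ g : Fin (p + 2) → G) b
    rw [Fin.sum_univ_succ, contractNth_zero_cons] at h
    simp only [contractNth_succ_cons] at h
    simp only [Finsupp.lmapDomain_apply, Finsupp.mapDomain_single, Finsupp.lsum_single]
    refine (congrArg (· + _) h).trans ?_
    simp only [Fin.cons_succ, Fin.cons_zero, Fin.val_zero, zero_add, Fin.val_succ, pow_succ, pow_zero,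
      mul_neg, mul_one, neg_smul, one_smul, neg_neg, Finset.sum_neg_distrib]
    abel

lemma d_contraction (p : ℕ) (x : (Fin (p + 1) → G) →₀ A) :
    (groupHomology.inhomogeneousChains.d A (p + 1)).hom (Γ.contraction (p + 1) x) +
      Γ.contraction p ((groupHomology.inhomogeneousChains.d A p).hom x) = x := by
  induction x using Finsupp.induction_linear with
  | zero => simp
  | add x y hx hy =>
    conv_rhs => rw [← hx, ← hy]
    simp only [map_add]
    abel
  | single g a =>
    have h := groupHomology.inhomogeneousChains.d_single (A := A) p g a
    have h' := congrArg (Γ.contraction p) h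
    refine (congrArg (_ + ·) h').trans ?_
    rw [map_add, map_sum]
    simp only [map_smul, contraction_single, c_ρ, inv_inv]
    rw [d_cons, sum_c]

lemma exists_d_eq (Γ : FreeGrading A) (p : ℕ) (x : (Fin (p + 1) → G) →₀ A)
    (hx : (groupHomology.inhomogeneousChains.d A p).hom x = 0) :
    ∃ y, (groupHomology.inhomogeneousChains.d A (p + 1)).hom y = x :=
  ⟨Γ.contraction (p + 1) x, by simpa [hx] using Γ.d_contraction p x⟩

lemma d_contraction_zero (a : A) (g : Fin 0 → G) :
    (groupHomology.inhomogeneousChains.d A 0).hom (Γ.contraction 0 (Finsupp.single g a)) =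
      Finsupp.single g (a - Γ.retract a) := by
  have key (u : G →₀ A) : (groupHomology.inhomogeneousChains.d A 0).hom
      (Finsupp.lmapDomain A k (fun γ => (Fin.cons γ g : Fin 1 → G)) u) =
        Finsupp.single g (Finsupp.lsum k (fun γ => A.ρ γ⁻¹) u -
          Finsupp.lsum k (fun _ => (LinearMap.id : A →ₗ[k] A)) u) := by
    induction u using Finsupp.induction_linear with
    | zero => simp
    | add u v hu hv =>
      simp only [map_add, hu, hv, ← Finsupp.single_add]
      congr 1
      abel
    | single γ b =>
      have h := groupHomology.inhomogeneousChains.d_single (A := A) 0 (Fin.cons γ g : Fin 1 → G) b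
      simp only [Finsupp.lmapDomain_apply, Finsupp.mapDomain_single, Finsupp.lsum_single]
      refine h.trans ?_
      rw [Finsupp.single_sub, sub_eq_add_neg]
      refine congrArg₂ (· + ·) (congrArg₂ _ (Subsingleton.elim _ _) rfl) ?_
      have hs (f : Fin (0 + 1) → ((Fin 0 → G) →₀ A)) : ∑ j, f j = f 0 := Fin.sum_univ_one f
      rw [hs, Subsingleton.elim (Fin.contractNth 0 _ _) g]
      simp
  rw [contraction_single, key, sum_c]
  rfl

end FreeGrading

end BarContraction

/-! ### Hyperhomology of a group with coefficients in a complex -/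

lemma exists_mapRange_eq {k : Type*} [CommRing k] {ι A B : Type*} [AddCommGroup A] [AddCommGroup B]
    [Module k A] [Module k B] (f : A →ₗ[k] B) (v : ι →₀ B) (h : ∀ i, ∃ a, f a = v i) :
    ∃ w : ι →₀ A, Finsupp.mapRange.linearMap f w = v := by
  classical
  choose a ha using h
  refine ⟨Finsupp.onFinset v.support (fun i => if v i = 0 then 0 else a i) fun i hi => ?_,
    Finsupp.ext fun i => ?_⟩
  · rw [Finsupp.mem_support_iff]
    rintro h
    exact hi (if_pos h)
  · rw [Finsupp.mapRange.linearMap_apply, Finsupp.mapRange_apply, Finsupp.onFinset_apply]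
    split_ifs with h
    · rw [map_zero, h]
    · exact ha i

lemma d_mapRange {k G : Type u} [CommRing k] [Group G] {A B : Rep.{u} k G} (f : A →ₗ[k] B)
    (hf : ∀ g a, f (A.ρ g a) = B.ρ g (f a)) (p : ℕ) (x : (Fin (p + 1) → G) →₀ A) :
    (groupHomology.inhomogeneousChains.d B p).hom (Finsupp.mapRange.linearMap f x) =
      Finsupp.mapRange.linearMap f ((groupHomology.inhomogeneousChains.d A p).hom x) := by
  induction x using Finsupp.induction_linear with
  | zero => simp only [map_zero]
  | add x y hx hy => simp only [map_add, hx, hy]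
  | single g a =>
    have h1 := groupHomology.inhomogeneousChains.d_single (A := B) p g (f a)
    have h2 := groupHomology.inhomogeneousChains.d_single (A := A) p g a
    rw [Finsupp.mapRange.linearMap_apply, Finsupp.mapRange_single]
    refine h1.trans (((congrArg (Finsupp.mapRange.linearMap f) h2).trans ?_).symm)
    simp only [map_add, map_sum, map_smul, Finsupp.mapRange.linearMap_apply, Finsupp.mapRange_single,
      hf]

section ComplexWithAction

variable {k G : Type u} [CommRing k] [Group G] {K : ChainComplex (ModuleCat.{u} k) ℕ} (α : G →* End K)

/-- The representation in degree `q` of a chain complex with an action of `G`. -/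
def termRep (q : ℕ) : Rep.{u} k G :=
  Rep.of (X := K.X q)
    { toFun := fun s => ((α s).f q).hom
      map_one' := by rw [map_one]; rfl
      map_mul' := fun s t => by rw [map_mul]; rfl }

/-- The representation of `G` on the cycles of degree `q`. -/
def cycleRep (q : ℕ) : Rep.{u} k G :=
  Rep.of (X := cycleSubmodule K q)
    { toFun := fun s => ((α s).f q).hom.restrict fun _ hx => map_mem_cycleSubmodule (α s) hx
      map_one' := by ext x; rw [map_one]; rfl
      map_mul' := fun s t => by ext x; rw [map_mul]; rfl }

/-- The representation of `G` on the homology of a chain complex with an action of `G`. -/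
def complexHomologyRep (q : ℕ) : Rep.{u} k G :=
  Rep.of (X := K.homology q)
    ((ModuleCat.endRingEquiv _).toMonoidHom.comp
      (((HomologicalComplex.homologyFunctor (ModuleCat.{u} k) (ComplexShape.down ℕ) q).mapEnd
        _).comp α))

lemma complexHomologyRep_ρ (q : ℕ) (s : G) (z : cycleSubmodule K q) :
    (complexHomologyRep α q).ρ s (homologyClass K q z) =
      homologyClass K q ((cycleRep α q).ρ s z) :=
  homologyMap_homologyClass (α s) q z

/-- The double complex of inhomogeneous chains of `G` with coefficients in a complex with an action
of `G`. -/
def barDoubleComplex : DoubleComplex k where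
  X p q := (Fin p → G) →₀ K.X q
  dh p q := (groupHomology.inhomogeneousChains.d (termRep α q) p).hom
  dv _ q := Finsupp.mapRange.linearMap (K.d (q + 1) q).hom
  dh_dh p q x := congrArg (fun f => f.hom x)
    (groupHomology.inhomogeneousChains.d_comp_d (termRep α q) p)
  dv_dv _ _ _ := Finsupp.ext fun _ => ChainFiltration.d_d _ _ _ _
  dh_dv p q x := d_mapRange (A := termRep α (q + 1)) (B := termRep α q) (K.d (q + 1) q).hom
    (fun g a => congrArg (fun f => f.hom a) ((α g).comm (q + 1) q)) p x

/-- The inclusion of chains with values in cycles. -/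
def cycleChains (G : Type u) (K : ChainComplex (ModuleCat.{u} k) ℕ) (p q : ℕ) :
    ((Fin p → G) →₀ cycleSubmodule K q) →ₗ[k] ((Fin p → G) →₀ K.X q) :=
  Finsupp.mapRange.linearMap (cycleSubmodule K q).subtype

lemma cycleChains_injective (G : Type u) (K : ChainComplex (ModuleCat.{u} k) ℕ) (p q : ℕ) :
    Function.Injective (cycleChains G K p q) :=
  Finsupp.mapRange_injective _ (map_zero _) Subtype.val_injective

lemma vCycles_le_range (p q : ℕ) :
    (barDoubleComplex α).vCycles p q ≤ LinearMap.range (cycleChains G K p q) := by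
  intro v hv
  change (Fin p → G) →₀ K.X q at v
  refine exists_mapRange_eq _ v fun g => ⟨⟨v g, mem_cycleSubmodule.2 fun j => ?_⟩, rfl⟩
  by_cases hj : (ComplexShape.down ℕ).Rel q j
  · obtain rfl : j + 1 = q := hj
    exact DFunLike.congr_fun (F := (Fin p → G) →₀ K.X j) hv g
  · rw [K.shape _ _ hj]
    rfl

/-- The passage from chains with values in cycles to chains with values in homology. -/
def classChains (p q : ℕ) :
    (barDoubleComplex α).vCycles p q →ₗ[k] ((Fin p → G) →₀ K.homology q) :=
  Finsupp.mapRange.linearMap (homologyClass K q) ∘ₗ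
    (LinearEquiv.ofInjective (cycleChains G K p q) (cycleChains_injective G K p q)).symm.toLinearMap ∘ₗ
    Submodule.inclusion (M := (Fin p → G) →₀ K.X q) (vCycles_le_range α p q)

lemma classChains_eq {p q : ℕ} (v : (barDoubleComplex α).vCycles p q)
    (w : (Fin p → G) →₀ cycleSubmodule K q) (h : cycleChains G K p q w = v.1) :
    classChains α p q v = Finsupp.mapRange.linearMap (homologyClass K q) w :=
  congrArg (Finsupp.mapRange.linearMap (homologyClass K q))
    ((LinearEquiv.symm_apply_eq _).2 (Subtype.ext h.symm))

lemma cycleChains_mem_vCycles {p q : ℕ} (w : (Fin p → G) →₀ cycleSubmodule K q) :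
    cycleChains G K p q w ∈ (barDoubleComplex α).vCycles p q := by
  cases q with
  | zero => trivial
  | succ q => exact Finsupp.ext fun g => mem_cycleSubmodule.1 (w g).2 q

lemma classChains_surjective (p q : ℕ) : Function.Surjective (classChains α p q) := by
  intro r
  obtain ⟨w, rfl⟩ := exists_mapRange_eq (homologyClass K q) r fun g => homologyClass_surjective K q _
  exact ⟨⟨_, cycleChains_mem_vCycles α w⟩, classChains_eq α _ w rfl⟩

lemma classChains_eq_zero_iff (p q : ℕ) (v : (barDoubleComplex α).vCycles p q) :
    classChains α p q v = 0 ↔ ∃ y, (barDoubleComplex α).dv p q y = v := by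
  obtain ⟨w, hw⟩ := vCycles_le_range α p q v.2
  rw [classChains_eq α v w hw, ← hw]
  constructor
  · intro h
    refine exists_mapRange_eq (K.d (q + 1) q).hom _ fun g => ?_
    obtain ⟨j, y, hy⟩ := (homologyClass_eq_zero_iff (w g)).1 (DFunLike.congr_fun h g)
    by_cases hj : (ComplexShape.down ℕ).Rel j q
    · obtain rfl : q + 1 = j := hj
      exact ⟨y, hy⟩
    · rw [K.shape _ _ hj] at hy
      exact ⟨0, (map_zero _).trans hy⟩
  · rintro ⟨y, hy⟩
    change (Fin p → G) →₀ K.X (q + 1) at y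
    change Finsupp.mapRange.linearMap (K.d (q + 1) q).hom y = _ at hy
    refine Finsupp.ext fun g => (homologyClass_eq_zero_iff (w g)).2 ⟨q + 1, y g, ?_⟩
    exact DFunLike.congr_fun hy g

lemma d_classChains (p q : ℕ) (v : (barDoubleComplex α).vCycles (p + 1) q) :
    (groupHomology.inhomogeneousChains (complexHomologyRep α q)).d (p + 1) p
        (classChains α (p + 1) q v) =
      classChains α p q ⟨(barDoubleComplex α).dh p q v, DoubleComplex.dh_mem_vCycles v.2⟩ := by
  rw [groupHomology.inhomogeneousChains.d_def]
  obtain ⟨w, hw⟩ := vCycles_le_range α _ q v.2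
  have h1 := d_mapRange (A := cycleRep α q) (B := complexHomologyRep α q) (homologyClass K q)
    (fun g z => (complexHomologyRep_ρ α q g z).symm) p w
  have h2 := d_mapRange (A := cycleRep α q) (B := termRep α q) (cycleSubmodule K q).subtype
    (fun g z => rfl) p w
  rw [classChains_eq α v w hw]
  refine h1.trans (classChains_eq α _ _ (h2.symm.trans ?_)).symm
  exact congrArg (groupHomology.inhomogeneousChains.d (termRep α q) p).hom hw

/-- The hyperhomology spectral sequence of a complex with an action of `G`. -/
theorem exists_hyperhomology_spectralSequence :
    ∃ E : FirstQuadrantSpectralSequence k,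
      (∀ p q : ℕ, Nonempty (pageTerm E 2 le_rfl p q ≅ groupHomology (complexHomologyRep α q) p)) ∧
      ConvergesTo E fun n => (barDoubleComplex α).total.homology n :=
  ⟨(barDoubleComplex α).filtration.spectralSequence, fun p q =>
    ⟨(DoubleComplex.secondPageIso (groupHomology.inhomogeneousChains (complexHomologyRep α q))
      (fun p => classChains α p q) (fun p => classChains_surjective α p q)
      (fun p => classChains_eq_zero_iff α p q) (fun p => d_classChains α p q) p).symm⟩,
    (barDoubleComplex α).filtration.convergesTo⟩

end ComplexWithAction

/-! ### Functoriality of the Hochschild–Mitchell complex -/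

section Functoriality

variable {k : Type u} [CommRing k] {C D : Type u} [SmallCategory C] [Preadditive C] [Linear k C]
  [SmallCategory D] [Preadditive D] [Linear k D] (F : C ⥤ D) [F.Additive] [F.Linear k]

/-- The image under `F` of the morphisms between consecutive objects of a sequence. -/
def edgesImage {n : ℕ} (x : Fin (n + 1) → C) (i : Fin n) : Edges x i →ₗ[k] Edges (F.obj ∘ x) i :=
  F.mapLinearMap k

lemma path_edgesImage {n : ℕ} (x : Fin (n + 1) → C) (c : ∀ i, Edges x i) (i j : Fin (n + 1))
    (h : i ≤ j) :
    path (F.obj ∘ x) (fun l => edgesImage (k := k) F x l (c l)) h = F.map (path x c h) := by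
  refine path_induction i (P := fun j h =>
    path (F.obj ∘ x) (fun l => edgesImage (k := k) F x l (c l)) h = F.map (path x c h))
    ?_ (fun j h ih => ?_) j h
  · rw [path_self, path_self]
    exact (F.map_id (x i)).symm
  · rw [← path_comp (F.obj ∘ x) _ h (Fin.castSucc_le_succ j),
      ← path_comp x c h (Fin.castSucc_le_succ j), path_succ, path_succ, ih]
    exact (F.map_comp _ _).symm

open scoped Classical

variable (M : Bimodule k D)

/-- The coefficients of the lifted bimodule are those of the original one. -/
def liftCoeff {n : ℕ} (x : Fin (n + 1) → C) : (M.lift F).obj (x (Fin.last n)) (x 0) ≃ₗ[k]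
    M.obj ((F.obj ∘ x) (Fin.last n)) ((F.obj ∘ x) 0) :=
  LinearEquiv.refl k _

/-- The map of chains `a ⊗ c_n ⊗ ⋯ ⊗ c_1 ↦ a ⊗ F c_n ⊗ ⋯ ⊗ F c_1` from the chains of the lifted
bimodule. -/
def chainsImage (n : ℕ) : Chains (M.lift F) n →ₗ[k] Chains M n :=
  DirectSum.toModule k _ _ fun x =>
    DirectSum.lof k (Fin (n + 1) → D) (fun x => ChainTerm M x) (F.obj ∘ x) ∘ₗ
      TensorProduct.map (liftCoeff F M x).toLinearMap (PiTensorProduct.map (edgesImage F x))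

lemma chainsImage_gen {n : ℕ} (x : Fin (n + 1) → C) (a : (M.lift F).obj (x (Fin.last n)) (x 0))
    (c : ∀ i, Edges x i) : chainsImage F M n (gen (M.lift F) x a c) =
      gen M (F.obj ∘ x) (liftCoeff F M x a) (fun i => edgesImage (k := k) F x i (c i)) := by
  rw [chainsImage, gen, DirectSum.toModule_lof, LinearMap.comp_apply, TensorProduct.map_tmul,
    PiTensorProduct.map_tprod]
  rfl

lemma chainsImage_operator {m n : ℕ} (θ : Fin (m + 1) →o Fin (n + 1)) :
    chainsImage F M m ∘ₗ operator (M.lift F) θ = operator M θ ∘ₗ chainsImage F M n := by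
  refine chains_ext _ fun x a c => ?_
  rw [LinearMap.comp_apply, LinearMap.comp_apply, chainsImage_gen, operator_gen, operator_gen,
    chainsImage_gen]
  refine gen_congr _ rfl (heq_of_eq ?_) fun i => heq_of_eq (path_edgesImage F x c _ _ _).symm
  rw [coeffMap_apply, coeffMap_apply, path_edgesImage, path_edgesImage]
  rfl

/-- The chain map `C_•(C, LM) → C_•(D, M)`. -/
def chainComplexImage : chainComplex (M.lift F) ⟶ chainComplex M :=
  (AlgebraicTopology.alternatingFaceMapComplex _).map
    { app := fun Δ => ModuleCat.ofHom (chainsImage F M Δ.unop.len)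
      naturality := fun _ _ f => ModuleCat.hom_ext (chainsImage_operator F M f.unop.toOrderHom) }

end Functoriality

/-! ### Coefficients of the morphisms of the quotient category -/

namespace FreeAction

variable {k : Type u} [CommRing k] {G : Type u} [Group G] {C : Type u}
    [SmallCategory C] [Preadditive C] [Linear k C] [MulAction G C] (A : FreeAction k G C)

lemma eq_of_smul_eq_smul (A : FreeAction k G C) {x : C} {g g' : G} (h : g • x = g' • x) : g = g' := by
  have h1 : (g'⁻¹ * g) • x = x := by rw [mul_smul, inv_smul_eq_iff, h]
  exact (inv_mul_eq_one.1 (A.free _ _ h1)).symm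

section Coefficients

open scoped Classical

/-- The translate of a morphism from `x'` to `y'` which goes from `x` to `y`, if there is one, and zero
otherwise. It is well defined because at most one element of `G` moves `x'` to `x`. -/
def translateTo {u v : MulAction.orbitRel.Quotient G C} (x : u.orbit) (y : v.orbit) (x' : u.orbit)
    (y' : v.orbit) : ((x' : C) ⟶ y') →ₗ[k] ((x : C) ⟶ y) :=
  if h : ∃ g : G, g • x' = x ∧ g • y' = y then
    Linear.rightComp k _ (eqToHom (congrArg Subtype.val h.choose_spec.2)) ∘ₗ
      Linear.leftComp k _ (eqToHom (congrArg Subtype.val h.choose_spec.1.symm)) ∘ₗ A.omap h.choose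
  else 0

lemma translateTo_heq {u v : MulAction.orbitRel.Quotient G C} (g : G) {x : u.orbit} {y : v.orbit}
    {x' : u.orbit} {y' : v.orbit} (hx : g • x' = x) (hy : g • y' = y) (c : (x' : C) ⟶ y') :
    HEq (A.translateTo x y x' y' c) (A.omap g c) := by
  have h : ∃ g : G, g • x' = x ∧ g • y' = y := ⟨g, hx, hy⟩
  obtain rfl : h.choose = g := A.smul_injective x' (h.choose_spec.1.trans hx.symm)
  rw [translateTo, dif_pos h]
  simp only [LinearMap.comp_apply, Linear.leftComp_apply, Linear.rightComp_apply]
  exact (comp_eqToHom_heq _ _).trans (eqToHom_comp_heq _ _)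

lemma translateTo_of_not {u v : MulAction.orbitRel.Quotient G C} {x : u.orbit} {y : v.orbit}
    {x' : u.orbit} {y' : v.orbit} (h : ¬ ∃ g : G, g • x' = x ∧ g • y' = y) (c : (x' : C) ⟶ y') :
    A.translateTo x y x' y' c = 0 := by
  rw [translateTo, dif_neg h, LinearMap.zero_apply]

/-- The coefficient of a morphism of the quotient category at a pair of objects: a morphism from the
orbit of `x` to the orbit of `y` is a `G`-invariant family of morphisms of `C`, of which this is the
member going from `x` to `y`. -/
def coef {u v : MulAction.orbitRel.Quotient G C} (x : u.orbit) (y : v.orbit) :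
    A.QuotientHom u v →ₗ[k] ((x : C) ⟶ y) :=
  A.qdesc (fun x' y' => A.translateTo x y x' y') fun s x' y' c => by
    by_cases h : ∃ g : G, g • s • x' = x ∧ g • s • y' = y
    · obtain ⟨g, hx, hy⟩ := h
      refine eq_of_heq ((A.translateTo_heq g hx hy _).trans ((A.omap_mul g s c).symm.trans ?_))
      exact (A.translateTo_heq (g * s) (by rwa [mul_smul]) (by rwa [mul_smul]) c).symm
    · rw [A.translateTo_of_not h, A.translateTo_of_not]
      rintro ⟨g, hx, hy⟩
      exact h ⟨g * s⁻¹, by rwa [mul_smul, inv_smul_smul], by rwa [mul_smul, inv_smul_smul]⟩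

lemma coef_cls_self {u v : MulAction.orbitRel.Quotient G C} (x : u.orbit) (y : v.orbit)
    (c : (x : C) ⟶ y) : A.coef x y (A.cls x y c) = c := by
  rw [coef, qdesc_cls]
  exact eq_of_heq ((A.translateTo_heq 1 (one_smul G x) (one_smul G y) c).trans (A.omap_one c))

/-- A coefficient at a pair of objects which is not a translate of the pair `(x', y')` vanishes on the
class of a morphism from `x'` to `y'`. The orbits are allowed to be equal only propositionally, as is
the case for the images in the quotient of two sequences of objects. -/
lemma coef_eq_zero {u u' v v' : MulAction.orbitRel.Quotient G C} (hu : u' = u) (hv : v' = v)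
    {x : u.orbit} {y : v.orbit} {x' : u'.orbit} {y' : v'.orbit}
    (h : ¬ ∃ g : G, g • (x' : C) = x ∧ g • (y' : C) = y) (c : (x' : C) ⟶ y')
    (β : A.QuotientHom u v) (hβ : HEq β (A.cls x' y' c)) : A.coef x y β = 0 := by
  subst hu hv
  cases hβ
  rw [coef, qdesc_cls]
  exact A.translateTo_of_not (fun ⟨g, hx, hy⟩ =>
    h ⟨g, congrArg Subtype.val hx, congrArg Subtype.val hy⟩) c

variable (M : Bimodule k A.QuotientCategory)

/-- The coefficients of a family of morphisms of the quotient category at a sequence of objects of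
`C`. -/
def edgesCoef {n : ℕ} (y : Fin (n + 1) → C) (i : Fin n) :
    Edges (A.proj.obj ∘ y) i →ₗ[k] Edges y i :=
  A.coef (A.self (y i.succ)) (A.self (y i.castSucc))

/-- The coordinate at a sequence `y` of objects of `C` of the chains of the quotient category. -/
def coordinate {n : ℕ} (y : Fin (n + 1) → C) :
    Chains M n →ₗ[k] ChainTerm (A.liftedBimodule M) y :=
  TensorProduct.map (liftCoeff A.proj M y).symm.toLinearMap (PiTensorProduct.map (A.edgesCoef y)) ∘ₗ
    DirectSum.component k (Fin (n + 1) → A.QuotientCategory) (fun x => ChainTerm M x) (A.proj.obj ∘ y)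

lemma coordinate_gen {n : ℕ} (y : Fin (n + 1) → C)
    (a : M.obj ((A.proj.obj ∘ y) (Fin.last n)) ((A.proj.obj ∘ y) 0))
    (β : ∀ i, Edges (A.proj.obj ∘ y) i) :
    A.coordinate M y (gen M (A.proj.obj ∘ y) a β) =
      (liftCoeff A.proj M y).symm a ⊗ₜ PiTensorProduct.tprod k fun i => A.edgesCoef y i (β i) := by
  rw [coordinate, LinearMap.comp_apply, gen, DirectSum.component.lof_self, TensorProduct.map_tmul,
    PiTensorProduct.map_tprod]
  rfl

lemma coordinate_gen_of_ne {n : ℕ} (y : Fin (n + 1) → C) {u : Fin (n + 1) → A.QuotientCategory}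
    (h : u ≠ A.proj.obj ∘ y) (a : M.obj (u (Fin.last n)) (u 0)) (β : ∀ i, Edges u i) :
    A.coordinate M y (gen M u a β) = 0 := by
  rw [coordinate, LinearMap.comp_apply, gen, DirectSum.component.of, dif_neg h, map_zero]

lemma edgesCoef_edgesImage {n : ℕ} (y : Fin (n + 1) → C) (i : Fin n) (c : Edges y i) :
    A.edgesCoef y i (edgesImage (k := k) A.proj y i c) = c :=
  A.coef_cls_self (A.self (y i.succ)) (A.self (y i.castSucc)) c

lemma coordinate_chainsImage_self {n : ℕ} (y : Fin (n + 1) → C)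
    (a : (A.liftedBimodule M).obj (y (Fin.last n)) (y 0)) (c : ∀ i, Edges y i) :
    A.coordinate M y (chainsImage A.proj M n (gen (A.liftedBimodule M) y a c)) =
      a ⊗ₜ PiTensorProduct.tprod k c := by
  rw [chainsImage_gen, coordinate_gen, LinearEquiv.symm_apply_apply]
  simp only [edgesCoef_edgesImage]

lemma exists_gen_eq {n : ℕ} {z z' : Fin (n + 1) → A.QuotientCategory} (h : z = z')
    (a : M.obj (z (Fin.last n)) (z 0)) (c : ∀ i, Edges z i) :
    ∃ (a' : M.obj (z' (Fin.last n)) (z' 0)) (c' : ∀ i, Edges z' i),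
      (∀ i, HEq (c' i) (c i)) ∧ gen M z a c = gen M z' a' c' := by
  subst h
  exact ⟨a, c, fun i => HEq.rfl, rfl⟩

/-- Since the action is free, two sequences of objects in the same orbits are translates of each other
as soon as all the pairs of consecutive objects are. -/
lemma exists_smul_eq_of_consecutive (A : FreeAction k G C) {n : ℕ} {x y : Fin (n + 1) → C}
    (h0 : A.proj.obj ∘ x = A.proj.obj ∘ y)
    (h : ∀ i : Fin n, ∃ g : G, g • x i.succ = y i.succ ∧ g • x i.castSucc = y i.castSucc) :
    ∃ g : G, g • x = y := by
  have h1 : (⟦y 0⟧ : MulAction.orbitRel.Quotient G C) = ⟦x 0⟧ :=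
    (congrArg QuotientCategory.orbit (congrFun h0 0)).symm
  obtain ⟨g, hg⟩ := Quotient.exact h1
  refine ⟨g, funext fun i => ?_⟩
  induction i using Fin.induction with
  | zero => exact hg
  | succ i ih =>
    obtain ⟨g', h2, h3⟩ := h i
    rw [A.eq_of_smul_eq_smul (ih.trans h3.symm)]
    exact h2

lemma coordinate_chainsImage_of_ne {n : ℕ} {x y : Fin (n + 1) → C} (hxy : ¬ ∃ g : G, g • x = y)
    (a : (A.liftedBimodule M).obj (x (Fin.last n)) (x 0)) (c : ∀ i, Edges x i) :
    A.coordinate M y (chainsImage A.proj M n (gen (A.liftedBimodule M) x a c)) = 0 := by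
  rw [chainsImage_gen]
  by_cases h : A.proj.obj ∘ x = A.proj.obj ∘ y
  · obtain ⟨i, hi⟩ := not_forall.1 fun H => hxy (A.exists_smul_eq_of_consecutive h H)
    obtain ⟨a', β, hβ, he⟩ := A.exists_gen_eq M h
      (liftCoeff A.proj M x a) (fun i => edgesImage (k := k) A.proj x i (c i))
    rw [he, coordinate_gen]
    have h0 : A.edgesCoef y i (β i) = 0 :=
      A.coef_eq_zero (x := A.self (y i.succ)) (y := A.self (y i.castSucc))
        (x' := A.self (x i.succ)) (y' := A.self (x i.castSucc))
        (congrArg QuotientCategory.orbit (congrFun h i.succ))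
        (congrArg QuotientCategory.orbit (congrFun h i.castSucc)) hi (c i) _ (hβ i)
    rw [MultilinearMap.map_coord_zero _ i h0]
    exact TensorProduct.tmul_zero _ _
  · exact A.coordinate_gen_of_ne M y h _ _

end Coefficients

/-! ### The complex of the covering and the complex of the quotient -/

section Covering

open scoped Classical

variable (M : Bimodule k A.QuotientCategory)

lemma chainsImage_chainsMap (s : G) (n : ℕ) (w : Chains (A.liftedBimodule M) n) :
    chainsImage A.proj M n (A.chainsMap M s n w) = chainsImage A.proj M n w := by
  refine LinearMap.congr_fun (f := chainsImage A.proj M n ∘ₗ A.chainsMap M s n)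
    (chains_ext _ fun x a c => ?_) w
  rw [LinearMap.comp_apply, chainsMap_gen, chainsImage_gen, chainsImage_gen]
  exact gen_congr M (funext fun i => A.toQuotient_smul s (x i)) (A.liftedEquiv_heq M s _ _ a)
    fun i => A.proj_map_smul s (c i)

/-- The element of `G` which moves `x` to the chosen object of its orbit. -/
def normalizer (G : Type u) [Group G] {C : Type u} [MulAction G C] (x : C) : G :=
  (Quotient.exact (Quotient.out_eq (⟦x⟧ : MulAction.orbitRel.Quotient G C))).choose

lemma normalizer_smul_self (G : Type u) [Group G] {C : Type u} [MulAction G C] (x : C) :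
    normalizer G x • x = Quotient.out (⟦x⟧ : MulAction.orbitRel.Quotient G C) :=
  (Quotient.exact (Quotient.out_eq (⟦x⟧ : MulAction.orbitRel.Quotient G C))).choose_spec

lemma normalizer_smul (A : FreeAction k G C) (s : G) (x : C) :
    normalizer G (s • x) = normalizer G x * s⁻¹ := by
  rw [eq_mul_inv_iff_mul_eq]
  apply A.eq_of_smul_eq_smul (x := x)
  rw [mul_smul, normalizer_smul_self, normalizer_smul_self, MulAction.orbitRel.Quotient.quotient_smul_eq]

/-- The map sending a chain on the sequence `x` to its translate by the element `γ` which moves `x 0`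
to the chosen object of its orbit, placed in degree `γ`. -/
def gradingMap (n : ℕ) :
    Chains (A.liftedBimodule M) n →ₗ[k] (G →₀ Chains (A.liftedBimodule M) n) :=
  DirectSum.toModule k _ _ fun x =>
    Finsupp.lsingle (normalizer G (x 0)) ∘ₗ A.chainsMap M (normalizer G (x 0)) n ∘ₗ
      DirectSum.lof k (Fin (n + 1) → C) (fun x => ChainTerm (A.liftedBimodule M) x) x

lemma gradingMap_gen {n : ℕ} (x : Fin (n + 1) → C)
    (a : (A.liftedBimodule M).obj (x (Fin.last n)) (x 0)) (c : ∀ i, Edges x i) :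
    A.gradingMap M n (gen (A.liftedBimodule M) x a c) = Finsupp.single (normalizer G (x 0))
      (A.chainsMap M (normalizer G (x 0)) n (gen (A.liftedBimodule M) x a c)) := by
  rw [gradingMap, gen, DirectSum.toModule_lof]
  rfl

/-- Since `G` acts freely on the objects, the chains of the covering are graded by `G`: the degree of
a chain on the sequence `x` is the element of `G` which moves `x 0` to the chosen object of its
orbit. -/
def freeGrading (n : ℕ) : FreeGrading (termRep (A.chainAction M) n) where
  c := A.gradingMap M n
  c_ρ s w := by
    refine LinearMap.congr_fun (f := A.gradingMap M n ∘ₗ A.chainsMap M s n)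
      (g := Finsupp.lmapDomain _ k (fun γ => γ * s⁻¹) ∘ₗ A.gradingMap M n)
      (chains_ext _ fun x a c => ?_) w
    rw [LinearMap.comp_apply, LinearMap.comp_apply, gradingMap_gen, chainsMap_gen, gradingMap_gen,
      ← chainsMap_gen, Finsupp.lmapDomain_apply, Finsupp.mapDomain_single]
    change Finsupp.single (normalizer G (s • x 0)) (A.chainsMap M (normalizer G (s • x 0)) n _) = _
    rw [A.normalizer_smul, ← LinearMap.comp_apply, ← chainsMap_mul, inv_mul_cancel_right]
  sum_c w := by
    refine LinearMap.congr_fun (f := Finsupp.lsum k (fun γ => A.chainsMap M γ⁻¹ n) ∘ₗ A.gradingMap M n)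
      (g := LinearMap.id) (chains_ext _ fun x a c => ?_) w
    rw [LinearMap.comp_apply, gradingMap_gen, Finsupp.lsum_single, ← LinearMap.comp_apply,
      ← chainsMap_mul, inv_mul_cancel, chainsMap_one]

/-- The projection of the chains of the covering onto those of degree `1`, by translation. -/
def orbitRetract (n : ℕ) : Chains (A.liftedBimodule M) n →ₗ[k] Chains (A.liftedBimodule M) n :=
  Finsupp.lsum k (fun _ : G => (LinearMap.id : Chains (A.liftedBimodule M) n →ₗ[k] _)) ∘ₗ
    A.gradingMap M n

lemma orbitRetract_gen {n : ℕ} (x : Fin (n + 1) → C)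
    (a : (A.liftedBimodule M).obj (x (Fin.last n)) (x 0)) (c : ∀ i, Edges x i) :
    A.orbitRetract M n (gen (A.liftedBimodule M) x a c) =
      A.chainsMap M (normalizer G (x 0)) n (gen (A.liftedBimodule M) x a c) := by
  rw [orbitRetract, LinearMap.comp_apply, gradingMap_gen, Finsupp.lsum_single, LinearMap.id_apply]

lemma component_gen_eq_coordinate {n : ℕ} (y : Fin (n + 1) → C) {x : Fin (n + 1) → C}
    (hx : normalizer G (x 0) = 1) (a : (A.liftedBimodule M).obj (x (Fin.last n)) (x 0))
    (c : ∀ i, Edges x i) :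
    DirectSum.component k (Fin (n + 1) → C) (fun x => ChainTerm (A.liftedBimodule M) x) y
      (gen (A.liftedBimodule M) x a c) =
      if normalizer G (y 0) = 1 then
        A.coordinate M y (chainsImage A.proj M n (gen (A.liftedBimodule M) x a c)) else 0 := by
  by_cases hxy : x = y
  · subst hxy
    rw [if_pos hx, coordinate_chainsImage_self, gen, DirectSum.component.lof_self]
  · have h0 : DirectSum.component k (Fin (n + 1) → C) (fun x => ChainTerm (A.liftedBimodule M) x) y
        (gen (A.liftedBimodule M) x a c) = 0 := by
      rw [gen, DirectSum.component.of, dif_neg hxy]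
    rw [h0]
    split_ifs with hy
    · -- two sequences of degree `1` which are translates of each other are equal
      refine (A.coordinate_chainsImage_of_ne M ?_ a c).symm
      rintro ⟨g, rfl⟩
      have h6 : normalizer G (x 0) * g⁻¹ = 1 := (A.normalizer_smul g (x 0)).symm.trans hy
      rw [hx, one_mul, inv_eq_one] at h6
      exact hxy (by rw [h6, one_smul])
    · rfl

/-- The components of the retract of a chain can be read off its image in the quotient. -/
lemma component_orbitRetract {n : ℕ} (y : Fin (n + 1) → C) (w : Chains (A.liftedBimodule M) n) :
    DirectSum.component k (Fin (n + 1) → C) (fun x => ChainTerm (A.liftedBimodule M) x) y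
      (A.orbitRetract M n w) =
      if normalizer G (y 0) = 1 then A.coordinate M y (chainsImage A.proj M n w) else 0 := by
  suffices h : DirectSum.component k _ (fun x => ChainTerm (A.liftedBimodule M) x) y ∘ₗ
      A.orbitRetract M n = if normalizer G (y 0) = 1 then
        A.coordinate M y ∘ₗ chainsImage A.proj M n else 0 by
    refine (LinearMap.congr_fun h w).trans ?_
    split_ifs <;> rfl
  refine chains_ext _ fun x a c => ?_
  have h2 := A.chainsImage_chainsMap M (normalizer G (x 0)) n (gen (A.liftedBimodule M) x a c)
  -- the normalized sequence of objects has degree `1`, and its chains have the same image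
  have h3 : normalizer G ((normalizer G (x 0) • x) 0) = 1 :=
    (A.normalizer_smul _ (x 0)).trans (mul_inv_cancel _)
  rw [chainsMap_gen] at h2
  rw [LinearMap.comp_apply, orbitRetract_gen, chainsMap_gen]
  have h5 : ((if normalizer G (y 0) = 1 then A.coordinate M y ∘ₗ chainsImage A.proj M n else 0 :
      Chains (A.liftedBimodule M) n →ₗ[k] _)) (gen (A.liftedBimodule M) x a c) =
      if normalizer G (y 0) = 1 then
        A.coordinate M y (chainsImage A.proj M n (gen (A.liftedBimodule M) x a c)) else 0 := by
    split_ifs <;> rfl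
  rw [h5, ← h2]
  exact A.component_gen_eq_coordinate M y h3 _ _

/-- A chain of the covering with zero image in the quotient has zero retract. -/
lemma orbitRetract_eq_zero {n : ℕ} {w : Chains (A.liftedBimodule M) n}
    (h : chainsImage A.proj M n w = 0) : A.orbitRetract M n w = 0 := by
  refine DFinsupp.ext fun y => (A.component_orbitRetract M y w).trans ?_
  rw [h, map_zero, ite_self]
  rfl

/-- A chain `a ⊗ β_n ⊗ ⋯ ⊗ β_1` of the quotient category in which all `β_i` from the position `j` on
are classes of composable morphisms of `C` comes from the covering: the other `β_i` are sums of such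
classes, one after the other. -/
lemma gen_mem_range_of_forall {n : ℕ} (u : Fin (n + 1) → A.QuotientCategory)
    (a : M.obj (u (Fin.last n)) (u 0)) (j : ℕ) :
    ∀ (β : ∀ i, Edges u i) (x : ∀ i, (u i).orbit.orbit)
      (_ : ∀ i : Fin n, j ≤ i → ∃ c : (x i.succ : C) ⟶ x i.castSucc, β i = A.cls _ _ c),
      gen M u a β ∈ LinearMap.range (chainsImage A.proj M n) := by
  induction j with
  | zero =>
    intro β x hβ
    choose c hc using fun i => hβ i (Nat.zero_le _)
    have hu : u = A.proj.obj ∘ fun i => (x i : C) := funext fun i =>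
      congrArg QuotientCategory.mk (MulAction.orbitRel.Quotient.mem_orbit.1 (x i).2).symm
    obtain ⟨a', β', hβ', he⟩ := A.exists_gen_eq M hu a β
    refine ⟨gen (A.liftedBimodule M) (fun i => (x i : C)) ((liftCoeff A.proj M _).symm a') c, ?_⟩
    rw [he, chainsImage_gen, LinearEquiv.apply_symm_apply]
    congr 1
    refine funext fun i => eq_of_heq (HEq.trans ?_ ((heq_of_eq (hc i)).symm.trans (hβ' i).symm))
    exact A.cls_smul_heq (congrArg QuotientCategory.orbit (congrFun hu i.succ)).symm
      (congrArg QuotientCategory.orbit (congrFun hu i.castSucc)).symm 1 (x i.succ) (x i.castSucc)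
      (A.self (x i.succ)) (A.self (x i.castSucc)) (one_smul G _).symm (one_smul G _).symm (c i) (c i)
      (A.map_one (c i)).symm
  | succ j ih =>
    intro β x hβ
    by_cases hj : n ≤ j
    · exact ih β x fun i hi => by lia
    let l : Fin n := ⟨j, by lia⟩
    let L : (⨂[k] i, Edges u i) →ₗ[k] Chains M n :=
      DirectSum.lof k (Fin (n + 1) → A.QuotientCategory) (fun x => ChainTerm M x) u ∘ₗ
        TensorProduct.mk k _ _ a
    have hL (β : ∀ i, Edges u i) : gen M u a β = L (PiTensorProduct.tprod k β) := rfl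
    have key (b : A.QuotientHom (u l.succ).orbit (u l.castSucc).orbit) :
        gen M u a (Function.update β l b) ∈ LinearMap.range (chainsImage A.proj M n) := by
      refine A.qhom_induction (x l.succ)
        (P := fun b => gen M u a (Function.update β l b) ∈ LinearMap.range (chainsImage A.proj M n))
        ?_ (fun b b' hb hb' => ?_) (fun y c => ?_) b
      · rw [hL, MultilinearMap.map_coord_zero _ l (Function.update_self ..), map_zero]
        exact zero_mem _
      · rw [hL]
        rw [MultilinearMap.map_update_add, map_add]
        exact add_mem hb hb'
      · refine ih _ (Function.update x l.castSucc y) fun i hi => ?_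
        have hi1 : i.succ ≠ l.castSucc := fun e => by
          have := congrArg Fin.val e
          simp only [Fin.val_succ, Fin.val_castSucc, l] at this
          lia
        rw [Function.update_of_ne hi1]
        by_cases hil : i = l
        · subst hil
          rw [Function.update_self, Function.update_self]
          exact ⟨c, rfl⟩
        · have hil' : (i : ℕ) ≠ j := fun e => hil (Fin.ext e)
          have hi2 : i.castSucc ≠ l.castSucc := fun e => hil (Fin.castSucc_injective _ e)
          rw [Function.update_of_ne hil, Function.update_of_ne hi2]
          exact hβ i (by lia)
    have := key (β l)
    rwa [Function.update_eq_self] at this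

lemma chainsImage_surjective (n : ℕ) : Function.Surjective (chainsImage A.proj M n) := by
  rw [← LinearMap.range_eq_top, ← Submodule.ker_mkQ (LinearMap.range _)]
  suffices h : (LinearMap.range (chainsImage A.proj M n)).mkQ = 0 by rw [h, LinearMap.ker_zero]
  refine chains_ext _ fun u a β => (Submodule.Quotient.mk_eq_zero _).2 ?_
  exact A.gen_mem_range_of_forall M u a n β (fun i => (u i).rep) fun i hi =>
    absurd i.2 (not_lt.2 hi)

end Covering

end FreeAction

/-! ### The spectral sequence of a Galois covering -/

namespace FreeAction

variable {k : Type u} [CommRing k] {G : Type u} [Group G] {C : Type u}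
    [SmallCategory C] [Preadditive C] [Linear k C] [MulAction G C] (A : FreeAction k G C)
    (M : Bimodule k A.QuotientCategory)

/-- The augmentation of the row of degree `q`: the map from the chains of the covering, which are the
inhomogeneous `0`-chains of `G`, to those of the quotient. -/
def augmentation (q : ℕ) : (barDoubleComplex (A.chainAction M)).X 0 q →ₗ[k] (chainComplex M).X q :=
  Finsupp.lsum k fun _ : Fin 0 → G => chainsImage A.proj M q

lemma augmentation_single (q : ℕ) (g : Fin 0 → G) (a : Chains (A.liftedBimodule M) q) :
    A.augmentation M q (Finsupp.single g a) = chainsImage A.proj M q a :=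
  Finsupp.lsum_single ..

lemma retract_eq_zero {q : ℕ} {w : Chains (A.liftedBimodule M) q}
    (h : chainsImage A.proj M q w = 0) : (A.freeGrading M q).retract w = 0 :=
  A.orbitRetract_eq_zero M h

/-- The total complex of the inhomogeneous chains of `G` with coefficients in `C_•(C, LM)` computes
the Hochschild–Mitchell homology of the quotient category. -/
def totalHomologyIso (n : ℕ) :
    (barDoubleComplex (A.chainAction M)).total.homology n ≅ homology M n := by
  refine DoubleComplex.homologyIsoOfAugmentation (chainComplex M) (A.augmentation M) ?_ ?_ ?_ ?_ ?_ n
  · intro q y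
    obtain ⟨x, rfl⟩ := A.chainsImage_surjective M q y
    exact ⟨Finsupp.single default x, A.augmentation_single M q _ x⟩
  · intro q x
    change (Fin 1 → G) →₀ Chains (A.liftedBimodule M) q at x
    induction x using Finsupp.induction_linear with
    | zero => exact (congrArg _ (map_zero _)).trans (map_zero _)
    | add x y hx hy =>
      refine (congrArg _ (map_add _ _ _)).trans ((map_add _ _ _).trans ?_)
      exact (congrArg₂ (· + ·) hx hy).trans (add_zero _)
    | single g a =>
      have h := groupHomology.inhomogeneousChains.d_single (A := termRep (A.chainAction M) q) 0 g a
      have hs (f : Fin (0 + 1) → ((Fin 0 → G) →₀ termRep (A.chainAction M) q)) : ∑ j, f j = f 0 :=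
        Fin.sum_univ_one f
      rw [hs] at h
      refine (congrArg (A.augmentation M q) h).trans ((map_add _ _ _).trans ?_)
      refine (congrArg₂ (· + ·) ((A.augmentation_single M q _ _).trans
        (A.chainsImage_chainsMap M (g 0)⁻¹ q a)) ((map_smul (A.augmentation M q) _ _).trans
          (congrArg _ (A.augmentation_single M q _ a)))).trans ?_
      have e : (-1 : k) ^ (((0 : Fin (0 + 1)) : ℕ) + 1) = -1 := by norm_num
      rw [e]
      have hneg (z : Chains M q) : z + (-1 : k) • z = 0 :=
        (congrArg (z + ·) (neg_one_smul k z)).trans (add_neg_cancel z)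
      exact hneg _
  · intro q x
    change (Fin 0 → G) →₀ Chains (A.liftedBimodule M) (q + 1) at x
    induction x using Finsupp.induction_linear with
    | zero =>
      refine (congrArg _ (map_zero _)).trans ((map_zero _).trans ?_)
      exact ((congrArg _ (map_zero _)).trans (map_zero _)).symm
    | add x y hx hy =>
      refine (congrArg _ (map_add _ _ _)).trans ((map_add _ _ _).trans ?_)
      refine (congrArg₂ (· + ·) hx hy).trans (((congrArg _ (map_add _ _ _)).trans (map_add _ _ _)).symm)
    | single g a =>
      refine (congrArg (A.augmentation M q) (Finsupp.mapRange_single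
        (f := (chainComplex (A.liftedBimodule M)).d (q + 1) q) (hf := map_zero _))).trans ?_
      refine (A.augmentation_single M q g _).trans ?_
      refine Eq.trans ?_ (congrArg ((chainComplex M).d (q + 1) q)
        (A.augmentation_single M (q + 1) g a)).symm
      exact congrArg (fun f => f.hom a) ((chainComplexImage A.proj M).comm (q + 1) q).symm
  · intro q x hx
    change (Fin 0 → G) →₀ Chains (A.liftedBimodule M) q at x
    obtain ⟨a, rfl⟩ : ∃ a, x = Finsupp.single default a := ⟨x default, Finsupp.unique_ext (by simp)⟩
    have hx' : chainsImage A.proj M q a = 0 := (A.augmentation_single M q default a).symm.trans hx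
    refine ⟨_, ((A.freeGrading M q).d_contraction_zero a default).trans ?_⟩
    rw [A.retract_eq_zero M hx']
    exact congrArg (Finsupp.single default) (sub_zero (G := Chains (A.liftedBimodule M) q) a)
  · intro p q x hx
    exact (A.freeGrading M q).exists_d_eq p x hx

end FreeAction

end
end CartanLeray

theorem mainTheorem1 {k : Type u} [Field k] {C : Type u} [SmallCategory C] [Preadditive C]
    [Linear k C] {G : Type u} [Group G] [MulAction G C] (A : CartanLeray.FreeAction k G C)
    (M : CartanLeray.Bimodule k A.QuotientCategory) :
    ∃ E : CartanLeray.FirstQuadrantSpectralSequence k,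
      (∀ p q : ℕ, Nonempty
        (CartanLeray.pageTerm E 2 le_rfl p q ≅ groupHomology (A.homologyRep M q) p)) ∧
      CartanLeray.ConvergesTo E (fun n => CartanLeray.homology M n) := by
  obtain ⟨E, h2, hE⟩ := CartanLeray.exists_hyperhomology_spectralSequence (A.chainAction M)
  exact ⟨E, h2, hE.of_iso (A.totalHomologyIso M)⟩
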